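/- Let $d,m\ge 1$ and $0\le\tilde q<\tilde p$ be integers and let $$\tilde P(z)=z^{\tilde p}\mathbf 1_d+\tilde A_1z^{\tilde p-1}+\dots+\tilde A_{\tilde p}\in M_d(\mathbb R[z]),\qquad \tilde Q(z)=\tilde B_0+\tilde B_1z+\dots+\tilde B_{\tilde q}z^{\tilde q}\in M_{d,m}(\mathbb R[z]).$$ Definitions. A two-sided $\mathbb R^m$-valued Lévy process is $L(t)=L_1(t)$ for $t\ge0$, $L(t)=-L_2((-t)-)$ for $t<0$, where $L_1,L_2$ are independent copies of a one-sided càdlàg Lévy process. For matrices $F,G,H$ of suitable sizes, a process $Y$ has the state space representation $dX(t)=FX(t)\,dt+G\,dL(t)$, $Y(t)=HX(t)$, $t\in\mathbb R$, if $X$ is a process with càdlàg paths such that almost surely $X(t)-X(s)=\int_s^tFX(u)\,du+G(L(t)-L(s))$ for all $s\le t$ and $Y(t)=HX(t)$ for all $t$. An $\mathbb R^d$-valued process $Y$ is an $L$-driven MCARMA process with autoregressive polynomial $\tilde P$ and moving average polynomial $\tilde Q$ if it has such a representation with $$F=\tilde{\mathbf A}=\begin{pmatrix}0&\mathbf 1_d&&\\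 &&\ddots&\\ 0&&&\mathbf 1_d\\-\tilde A_{\tilde p}&-\tilde A_{\tilde p-1}&\cdots&-\tilde A_1\end{pmatrix},\quad G=\begin{pmatrix}\beta_1\\\vdots\\\beta_{\tilde p}\end{pmatrix},\quad H=(\mathbf 1_d,0,\dots,0),$$ where, for $0\le j\le\tilde p-1$, $\beta_{\tilde p-j}=\tilde B_j-\sum_{i=1}^{\tilde p-j-1}\tilde A_i\beta_{\tilde p-j-i}$ if $j\le\tilde q$ and $\beta_{\tilde p-j}=0$ if $j>\tilde q$. It is called stationary if the state process $X$ can be chosen strictly stationary. Theorem (controller canonical state space representation). There exist integers $p>q>0$ and matrix polynomials $$P(z)=z^p\mathbf 1_m+A_1z^{p-1}+\dots+A_p\in M_m(\mathbb R[z]),\qquad Q(z)=B_0+B_1z+\dots+B_qz^q\in M_{d,m}(\mathbb R[z]),$$ with $B_q\ne0$ if $\tilde Q\neq0$, such that, for all $z\in\mathbb C$, $\det P(z)=0$ if and only if $\det\tilde P(z)=0$, and $\tilde P(z)^{-1}\tilde Q(z)=Q(z)P(z)^{-1}$ for all $z\in\mathbb C$ at which these inverses exist, i.e. with $\det\tilde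 P(z)\ne0$. Moreover, for every probability space, every two-sided $m$-dimensional Lévy process $L$ on it and every $L$-driven MCARMA process $Y$ with autoregressive polynomial $\tilde P$ and moving average polynomial $\tilde Q$ such that (a) $\tilde P,\tilde Q$ are left coprime, i.e. $\operatorname{rank}[\tilde P(z)\ \tilde Q(z)]=d$ for all $z\in\mathbb C$, or (b) $\det\tilde P$ has no zeros on the imaginary axis and $Y$ is stationary, the process $Y$ has the state space representation $$dX(t)=\mathbf A X(t)\,dt+E_p\,dL(t),\qquad Y(t)=\underline B X(t),\qquad t\in\mathbb R,$$ where $$\mathbf A=\begin{pmatrix}0&\mathbf 1_m&&\\ &&\ddots&\\ 0&&&\mathbf 1_m\\-A_p&-A_{p-1}&\cdots&-A_1\end{pmatrix}\in M_{pm}(\mathbb R),\quad E_p=\begin{pmatrix}0\\\vdots\\0\\\mathbf 1_m\end{pmatrix}\in M_{pm,m}(\mathbb R),\quad \underline B=(B_0\ B_1\ \cdots\ B_{p-1})\in M_{d,pm}(\mathbb R),$$ with $B_j=0$ for $q+1\le j\le p-1$. -/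

import Mathlib

open MeasureTheory ProbabilityTheory Filter Topology Polynomial
open scoped NNReal Matrix

noncomputable section

namespace MCARMA

/-! ### Matrix polynomials -/

/-- The monic matrix polynomial `z ^ p + A 1 z ^ (p - 1) + ⋯ + A p`. -/
def arPoly {n : Type*} [DecidableEq n] (p : ℕ) (A : ℕ → Matrix n n ℝ) : Matrix n n ℝ[X] :=
  (X : ℝ[X]) ^ p • (1 : Matrix n n ℝ[X]) +
    ∑ i ∈ Finset.Icc 1 p, (X : ℝ[X]) ^ (p - i) • (A i).map C

/-- The matrix polynomial `B 0 + B 1 z + ⋯ + B q z ^ q`. -/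
def maPoly {k n : Type*} (q : ℕ) (B : ℕ → Matrix k n ℝ) : Matrix k n ℝ[X] :=
  ∑ j ∈ Finset.range (q + 1), (X : ℝ[X]) ^ j • (B j).map C

/-- The value in `M_{k,n}(ℂ)` of a real matrix polynomial at a complex number `z`. -/
def evalAt {k n : Type*} (M : Matrix k n ℝ[X]) (z : ℂ) : Matrix k n ℂ :=
  M.map fun f => aeval z f

/-- Left coprimeness: `[P(z) Q(z)]` has full row rank at every complex `z`. -/
def LeftCoprime {d m : ℕ} (P : Matrix (Fin d) (Fin d) ℝ[X]) (Q : Matrix (Fin d) (Fin m) ℝ[X]) :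
    Prop :=
  ∀ z : ℂ, (Matrix.fromCols (evalAt P z) (evalAt Q z)).rank = d

/-! ### Coefficient matrices

The index type `Fin p × n` enumerates the rows of a matrix made of `p` blocks of size `n`,
the first component being the (zero-based) number of the block. -/

/-- The multi-companion matrix of `z ^ p + A 1 z ^ (p - 1) + ⋯ + A p`: identity blocks on the first
block superdiagonal and last block row `(-A p, -A (p - 1), …, -A 1)`. -/
def companion {n : Type*} [DecidableEq n] (p : ℕ) (A : ℕ → Matrix n n ℝ) :
    Matrix (Fin p × n) (Fin p × n) ℝ :=
  Matrix.of fun r c =>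
    if (r.1 : ℕ) + 1 < p then
      if (c.1 : ℕ) = (r.1 : ℕ) + 1 ∧ r.2 = c.2 then 1 else 0
    else -(A (p - (c.1 : ℕ)) r.2 c.2)

/-- The input matrix `E_p = (0, …, 0, 1)ᵀ` of the controller canonical form. -/
def controllerInput {n : Type*} [DecidableEq n] (p : ℕ) : Matrix (Fin p × n) n ℝ :=
  Matrix.of fun r b => if (r.1 : ℕ) + 1 = p ∧ r.2 = b then 1 else 0

/-- The output matrix `(B 0, …, B q, 0, …, 0)`, with `p` blocks, of the controller canonical
form. -/
def controllerOutput {k n : Type*} (p q : ℕ) (B : ℕ → Matrix k n ℝ) : Matrix k (Fin p × n) ℝ :=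
  Matrix.of fun a c => if (c.1 : ℕ) ≤ q then B (c.1 : ℕ) a c.2 else 0

/-- The blocks `β 1, …, β p` of the input matrix of the observer canonical form:
`β k = B (p - k) - ∑ i = 1, …, k - 1, A i * β (k - i)` if `p - k ≤ q`, and `β k = 0` otherwise. -/
def observerCoeff {k n : Type*} [Fintype k] (p q : ℕ) (A : ℕ → Matrix k k ℝ)
    (B : ℕ → Matrix k n ℝ) (l : ℕ) : Matrix k n ℝ :=
  if p - l ≤ q then
    B (p - l) - ∑ i : Fin (l - 1), A ((i : ℕ) + 1) * observerCoeff p q A B (l - ((i : ℕ) + 1))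
  else 0
termination_by l
decreasing_by have := i.isLt; omega

/-- The input matrix `(β 1, …, β p)ᵀ` of the observer canonical form. -/
def observerInput {k n : Type*} [Fintype k] (p q : ℕ) (A : ℕ → Matrix k k ℝ)
    (B : ℕ → Matrix k n ℝ) : Matrix (Fin p × k) n ℝ :=
  Matrix.of fun r b => observerCoeff p q A B ((r.1 : ℕ) + 1) r.2 b

/-- The output matrix `(1, 0, …, 0)` of the observer canonical form. -/
def observerOutput {k : Type*} [DecidableEq k] (p : ℕ) : Matrix k (Fin p × k) ℝ :=
  Matrix.of fun a c => if (c.1 : ℕ) = 0 ∧ a = c.2 then 1 else 0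

/-! ### Stochastic processes -/

/-- Right-continuous paths with left limits. -/
def IsCadlag {T E : Type*} [TopologicalSpace T] [LinearOrder T] [TopologicalSpace E]
    (f : T → E) : Prop :=
  ∀ t, ContinuousWithinAt f (Set.Ici t) t ∧ ∃ l, Tendsto f (𝓝[<] t) (𝓝 l)

/-- One-sided `ℝ^m`-valued Lévy processes with càdlàg paths. -/
structure IsLevyProcess {Ω : Type*} [MeasurableSpace Ω] (μ : Measure Ω) {m : ℕ}
    (L : ℝ≥0 → Ω → Fin m → ℝ) : Prop where
  measurable : ∀ t, Measurable (L t)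
  zero : ∀ᵐ ω ∂μ, L 0 ω = 0
  indep_increments : HasIndepIncrements L μ
  stationary_increments : ∀ s h : ℝ≥0,
    IdentDistrib (fun ω => L (s + h) ω - L s ω) (fun ω => L h ω - L 0 ω) μ μ
  continuous_in_probability : ∀ t, TendstoInMeasure μ L (𝓝 t) (L t)
  cadlag : ∀ ω, IsCadlag fun t => L t ω

/-- Two-sided Lévy processes: `L t = L₁ t` for `t ≥ 0` and `L t = -L₂ ((-t)-)` for `t < 0`, where
`L₁` and `L₂` are independent copies of a one-sided càdlàg Lévy process. -/
def IsTwoSidedLevyProcess {Ω : Type*} [MeasurableSpace Ω] (μ : Measure Ω) {m : ℕ}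
    (L : ℝ → Ω → Fin m → ℝ) : Prop :=
  ∃ L₁ L₂ : ℝ≥0 → Ω → Fin m → ℝ,
    IsLevyProcess μ L₁ ∧ IsLevyProcess μ L₂ ∧
    IndepFun (fun ω t => L₁ t ω) (fun ω t => L₂ t ω) μ ∧
    IdentDistrib (fun ω t => L₁ t ω) (fun ω t => L₂ t ω) μ μ ∧
    (∀ (t : ℝ≥0) (ω : Ω), L t ω = L₁ t ω) ∧
    (∀ (t : ℝ≥0) (ω : Ω), 0 < t →
      Tendsto (fun s => L₂ s ω) (𝓝[<] t) (𝓝 (-(L (-(t : ℝ)) ω))))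

/-- Strict stationarity: all finite-dimensional distributions are shift-invariant. -/
def IsStrictlyStationary {Ω : Type*} [MeasurableSpace Ω] (μ : Measure Ω) {ι : Type*}
    (X : ℝ → Ω → ι → ℝ) : Prop :=
  ∀ (n : ℕ) (t : Fin n → ℝ) (h : ℝ),
    IdentDistrib (fun ω i => X (t i + h) ω) (fun ω i => X (t i) ω) μ μ

/-- `dX(t) = A X(t) dt + B dL(t)`, `Y(t) = C X(t)`, for `t ∈ ℝ`, where `X` is a càdlàg process. -/
structure IsStateSpaceRepresentation {Ω : Type*} [MeasurableSpace Ω] (μ : Measure Ω) {d m : ℕ}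
    {ι : Type*} [Fintype ι] (A : Matrix ι ι ℝ) (B : Matrix ι (Fin m) ℝ)
    (C : Matrix (Fin d) ι ℝ) (L : ℝ → Ω → Fin m → ℝ) (X : ℝ → Ω → ι → ℝ)
    (Y : ℝ → Ω → Fin d → ℝ) : Prop where
  measurable : ∀ t, Measurable (X t)
  cadlag : ∀ᵐ ω ∂μ, IsCadlag fun t => X t ω
  state : ∀ᵐ ω ∂μ, ∀ s t : ℝ, s ≤ t →
    X t ω - X s ω = (∫ u in s..t, A *ᵥ X u ω) + B *ᵥ (L t ω - L s ω)
  output : ∀ᵐ ω ∂μ, ∀ t : ℝ, Y t ω = C *ᵥ X t ω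

/-- `X` is a state process exhibiting `Y` as an `L`-driven MCARMA process with autoregressive
polynomial `arPoly p A` and moving average polynomial `maPoly q B` (observer canonical form). -/
def IsMCARMAState {Ω : Type*} [MeasurableSpace Ω] (μ : Measure Ω) {d m : ℕ} (p q : ℕ)
    (A : ℕ → Matrix (Fin d) (Fin d) ℝ) (B : ℕ → Matrix (Fin d) (Fin m) ℝ)
    (L : ℝ → Ω → Fin m → ℝ) (X : ℝ → Ω → Fin p × Fin d → ℝ) (Y : ℝ → Ω → Fin d → ℝ) : Prop :=
  IsStateSpaceRepresentation μ (companion p A) (observerInput p q A B) (observerOutput p) L X Y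

/-- `Y` is an `L`-driven MCARMA process. -/
def IsMCARMA {Ω : Type*} [MeasurableSpace Ω] (μ : Measure Ω) {d m : ℕ} (p q : ℕ)
    (A : ℕ → Matrix (Fin d) (Fin d) ℝ) (B : ℕ → Matrix (Fin d) (Fin m) ℝ)
    (L : ℝ → Ω → Fin m → ℝ) (Y : ℝ → Ω → Fin d → ℝ) : Prop :=
  ∃ X, IsMCARMAState μ p q A B L X Y

/-- `Y` is a stationary `L`-driven MCARMA process: it comes from a strictly stationary solution of
its state equation. -/
def IsStationaryMCARMA {Ω : Type*} [MeasurableSpace Ω] (μ : Measure Ω) {d m : ℕ} (p q : ℕ)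
    (A : ℕ → Matrix (Fin d) (Fin d) ℝ) (B : ℕ → Matrix (Fin d) (Fin m) ℝ)
    (L : ℝ → Ω → Fin m → ℝ) (Y : ℝ → Ω → Fin d → ℝ) : Prop :=
  ∃ X, IsMCARMAState μ p q A B L X Y ∧ IsStrictlyStationary μ X

end MCARMA

end

namespace MCARMA

/-! ### Matrix polynomials and the canonical forms -/

section Algebra

variable {k n : Type*}

/-! Write (F, G, H) for the observer form and χ for the characteristic polynomial of F, whose zeros
are those of det P̃. Two polynomial identities for the Horner block row M, namely P̃H = M(z - F) and
MG = Q̃, give P̃⁻¹Q̃ = H(z - F)⁻¹G. Hence P = χ²·1 and Q = χ·H adj(z - F) G form a right fraction of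
the same transfer function. The denominator χ alone would give the same function, but its numerator
can be constant; the extra factor χ makes every nonzero entry of Q have positive degree, so that q >
0 is possible. The controller form (F', G', H') of (P, Q) realizes QP⁻¹, so expansion at infinity
gives equal Markov parameters H Fʲ G = H' F'ʲ G' (`markov_parameters_eq`).

The probabilistic part is pathwise. By `IsPathSolution.output_eq`, two systems with the same input
and the same Markov parameters have the same output if they start from ∑ Fʲ G vⱼ and ∑ F'ʲ G' vⱼ
with common v. In the joint system let r be a row vector annihilating the reachable subspace. The
noise drops out of r·x, and if r(F - z) already vanishes along the path, then r·x is a multiple of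
exp(zt) and vanishes with its initial value. Peeling off the roots of the characteristic polynomial
one at a time (`forall_mem_of_charpoly_roots`, by Cayley–Hamilton) covers all such r, in particular
the rows of (H, -H').

It remains that X(0) is reachable. In case (a) coprimeness makes every state reachable, which is the
Hautus test. In case (b) the same peeling applies: a functional of a stationary process that evolves
like exp(zt) with Re z ≠ 0 must be zero almost surely. The new state process then starts from a
linear image of X(0) and is built by variation of constants. -/

lemma arPoly_zero [DecidableEq n] (A : ℕ → Matrix n n ℝ) : arPoly 0 A = 1 := by
  simp [arPoly]

lemma arPoly_eq_sum_range [DecidableEq n] (p : ℕ) (A : ℕ → Matrix n n ℝ) :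
    arPoly p A = (X : ℝ[X]) ^ p • (1 : Matrix n n ℝ[X]) +
      ∑ c ∈ Finset.range p, (X : ℝ[X]) ^ c • (A (p - c)).map C := by
  rw [arPoly]
  congr 1
  refine Finset.sum_bij' (fun i _ => p - i) (fun c _ => p - c) ?_ ?_ ?_ ?_ ?_ <;>
    simp only [Finset.mem_Icc, Finset.mem_range]
  · intros; omega
  · intros; omega
  · intros; omega
  · intros; omega
  · intro i hi
    rw [show p - (p - i) = i by omega]

lemma arPoly_succ [DecidableEq n] (p : ℕ) (A : ℕ → Matrix n n ℝ) :
    arPoly (p + 1) A = (X : ℝ[X]) • arPoly p A + (A (p + 1)).map C := by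
  rw [arPoly_eq_sum_range, arPoly_eq_sum_range, Finset.sum_range_succ', smul_add, smul_smul,
    ← pow_succ', Finset.smul_sum, add_assoc]
  simp [smul_smul, pow_succ']

/-- The matrix `M` with blocks `z ^ (p - c) + A 1 z ^ (p - c - 1) + ⋯ + A (p - c)`, `c = 1, …, p`,
which intertwines `arPoly p A` and the pencil of its companion matrix. -/
noncomputable def hornerRow [DecidableEq k] (p : ℕ) (A : ℕ → Matrix k k ℝ) : Matrix k (Fin p × k) ℝ[X] :=
  Matrix.of fun a c => arPoly (p - 1 - c.1) A a c.2

/-- Horner's recursion `arPoly_succ` makes consecutive blocks of M(z - F) cancel, leaving only the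
first. Read as H(z - F)⁻¹ = P⁻¹M, this is half of the transfer function of the observer form. -/
lemma arPoly_mul_observerOutput [Fintype k] [DecidableEq k] (p : ℕ) (A : ℕ → Matrix k k ℝ) :
    arPoly p A * ((observerOutput p).map C : Matrix k (Fin p × k) ℝ[X]) =
      hornerRow p A * (companion p A).charmatrix := by
  ext1 a ⟨c, b⟩
  obtain _ | p := p
  · exact c.elim0
  have h1 : (arPoly (p + 1) A * ((observerOutput (p + 1)).map C :
      Matrix k (Fin (p + 1) × k) ℝ[X])) a (c, b) =
      if (c : ℕ) = 0 then arPoly (p + 1) A a b else 0 := by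
    simp only [Matrix.mul_apply, Matrix.map_apply, observerOutput, Matrix.of_apply]
    split_ifs with h <;> simp [h, apply_ite C]
  have h2 : (hornerRow (p + 1) A * (companion (p + 1) A).charmatrix) a (c, b) =
      (X : ℝ[X]) * arPoly (p - c) A a b + C (A (p + 1 - c) a b) -
        if (c : ℕ) = 0 then 0 else arPoly (p + 1 - c) A a b := by
    simp only [Matrix.charmatrix, Matrix.mul_sub, Matrix.sub_apply, Matrix.scalar_apply,
      Matrix.mul_diagonal, RingHom.mapMatrix_apply]
    rw [Matrix.mul_apply, Fintype.sum_prod_type, Fin.sum_univ_castSucc]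
    simp only [hornerRow, Matrix.of_apply, Matrix.map_apply, companion, Fin.val_castSucc,
      Fin.val_last, Nat.add_sub_cancel, lt_irrefl, if_false, add_lt_add_iff_right, Fin.is_lt,
      if_true, Nat.sub_self, arPoly_zero]
    have e1 : ∑ i : Fin p, ∑ x : k, arPoly (p - i) A a x *
        C (if (c : ℕ) = i + 1 ∧ x = b then (1 : ℝ) else 0) =
        if (c : ℕ) = 0 then 0 else arPoly (p + 1 - c) A a b := by
      have : ∀ i : Fin p, ∑ x : k, arPoly (p - i) A a x *
          C (if (c : ℕ) = i + 1 ∧ x = b then (1 : ℝ) else 0) =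
          if (c : ℕ) = i + 1 then arPoly (p - i) A a b else 0 := by
        intro i
        split_ifs with h <;> simp [h, apply_ite C]
      simp only [this]
      split_ifs with h
      · simp [h]
      · obtain ⟨j, hj⟩ := Nat.exists_eq_succ_of_ne_zero h
        have hjp : j < p := by have := c.2; omega
        rw [Finset.sum_eq_single ⟨j, hjp⟩]
        · rw [if_pos hj, show p + 1 - (c : ℕ) = p - j by omega]
        · intro i _ hi
          rw [if_neg]
          intro h'
          exact hi (Fin.ext (by simp only; omega))
        · simp
    have e2 : ∑ x : k, (1 : Matrix k k ℝ[X]) a x * C (-A (p + 1 - c) x b) =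
        - C (A (p + 1 - c) a b) := by
      simp [Matrix.one_apply]
    rw [e1, e2]
    ring
  have h3 : arPoly (p + 1 - c) A a b = (X : ℝ[X]) * arPoly (p - c) A a b +
      C (A (p + 1 - c) a b) := by
    rw [show p + 1 - (c : ℕ) = (p - c) + 1 by have := c.2; omega, arPoly_succ]
    simp
  rw [h1, h2, ← h3]
  split_ifs with h <;> simp [h]

/-- The defining recursion in convolution form. In the range where β is set to 0 by fiat, all
earlier β vanish as well, so the same identity holds there. -/
lemma observerCoeff_eq [Fintype k] (p q : ℕ) (A : ℕ → Matrix k k ℝ) (B : ℕ → Matrix k n ℝ) (l : ℕ) :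
    observerCoeff p q A B (l + 1) + ∑ i ∈ Finset.range l, A (l - i) * observerCoeff p q A B (i + 1)
      = if p - (l + 1) ≤ q then B (p - (l + 1)) else 0 := by
  have hs : ∑ i : Fin (l + 1 - 1), A ((i : ℕ) + 1) * observerCoeff p q A B (l + 1 - ((i : ℕ) + 1)) =
      ∑ i ∈ Finset.range l, A (l - i) * observerCoeff p q A B (i + 1) := by
    rw [Nat.add_sub_cancel, ← Finset.sum_range_reflect,
      Finset.sum_range (n := l)]
    refine Finset.sum_congr rfl fun i _ => ?_
    have := i.2
    congr 2 <;> omega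
  have h1 : observerCoeff p q A B (l + 1) = if p - (l + 1) ≤ q then B (p - (l + 1)) -
      ∑ i ∈ Finset.range l, A (l - i) * observerCoeff p q A B (i + 1) else 0 := by
    rw [observerCoeff, hs]
  split_ifs with h
  · rw [h1, if_pos h, sub_add_cancel]
  · have h0 : ∀ j ≤ l, observerCoeff p q A B (j + 1) = 0 := by
      intro j hj
      rw [observerCoeff, if_neg (by omega)]
    rw [h0 l le_rfl, zero_add]
    refine Finset.sum_eq_zero fun i hi => ?_
    rw [h0 i (Finset.mem_range.1 hi).le, Matrix.mul_zero]

lemma maPoly_eq_sum_range {p q : ℕ} (hpq : q < p) (B : ℕ → Matrix k n ℝ) :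
    maPoly q B = ∑ j ∈ Finset.range p,
      (X : ℝ[X]) ^ j • (if j ≤ q then B j else 0).map C := by
  rw [maPoly]
  refine Finset.sum_subset_zero_on_sdiff ?_ ?_ ?_
  · intro j
    simp only [Finset.mem_range]
    omega
  · intro j hj
    simp only [Finset.mem_sdiff, Finset.mem_range] at hj
    rw [if_neg (by omega)]
    simp [Matrix.map_zero]
  · intro j hj
    rw [if_pos (by simpa [Nat.lt_succ_iff] using hj)]

/-- The β are designed for this: the convolution identity says that the coefficients of MG are the
B's. Induction on the number of blocks, one Horner step at a time. -/
lemma hornerRow_mul_observerInput [Fintype k] [DecidableEq k] {p q : ℕ} (hpq : q < p) (A : ℕ → Matrix k k ℝ)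
    (B : ℕ → Matrix k n ℝ) :
    hornerRow p A * (observerInput p q A B).map C = maPoly q B := by
  set β := observerCoeff p q A B with hβ
  have hsum : ∀ l, ∑ c ∈ Finset.range l, arPoly (l - 1 - c) A * (β (c + 1)).map C =
      ∑ j ∈ Finset.range l, (X : ℝ[X]) ^ (l - 1 - j) •
        (if p - (j + 1) ≤ q then B (p - (j + 1)) else 0).map C := by
    intro l
    induction l with
    | zero => simp
    | succ l ih =>
      have h1 : ∑ c ∈ Finset.range l, arPoly (l - c) A * (β (c + 1)).map C =
          (X : ℝ[X]) • (∑ c ∈ Finset.range l, arPoly (l - 1 - c) A * (β (c + 1)).map C) +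
          (∑ c ∈ Finset.range l, A (l - c) * β (c + 1)).map C := by
        rw [Finset.smul_sum, ← RingHom.coe_coe (C : ℝ →+* ℝ[X])]
        have hmap : (∑ c ∈ Finset.range l, A (l - c) * β (c + 1)).map (C : ℝ →+* ℝ[X]) =
            ∑ c ∈ Finset.range l, (A (l - c) * β (c + 1)).map (C : ℝ →+* ℝ[X]) := by
          ext1 i j
          simp only [Matrix.sum_apply, map_sum, Matrix.map_apply]
        erw [hmap]
        rw [← Finset.sum_add_distrib]
        refine Finset.sum_congr rfl fun c hc => ?_
        rw [Finset.mem_range] at hc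
        rw [Matrix.map_mul, show l - c = (l - 1 - c) + 1 by omega, arPoly_succ,
          Matrix.add_mul, Matrix.smul_mul]
        rfl
      rw [Finset.sum_range_succ, Finset.sum_range_succ]
      simp only [Nat.add_sub_cancel, Nat.sub_self, arPoly_zero, Matrix.one_mul, pow_zero, one_smul]
      rw [h1, ih, add_assoc, ← observerCoeff_eq p q A B l, Finset.smul_sum]
      congr 1
      · refine Finset.sum_congr rfl fun j hj => ?_
        rw [Finset.mem_range] at hj
        rw [smul_smul, ← pow_succ', show l - 1 - j + 1 = l - j by omega]
      · rw [add_comm, Matrix.map_add _ (fun _ _ => C_add)]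
  have h2 := hsum p
  rw [← Finset.sum_range_reflect (fun j => (X : ℝ[X]) ^ (p - 1 - j) • _)] at h2
  rw [maPoly_eq_sum_range hpq]
  trans ∑ c ∈ Finset.range p, arPoly (p - 1 - c) A * (β (c + 1)).map C
  · ext1 a b
    rw [Matrix.mul_apply, Fintype.sum_prod_type, Matrix.sum_apply, Finset.sum_range]
    rfl
  · rw [h2]
    refine Finset.sum_congr rfl fun j hj => ?_
    rw [Finset.mem_range] at hj
    rw [show p - 1 - (p - 1 - j) = j by omega, show p - (p - 1 - j + 1) = j by omega]

/-- The block column `(1, z, …, z ^ (p - 1))ᵀ`. -/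
noncomputable def powerColumn (n : Type*) [DecidableEq n] (p : ℕ) : Matrix (Fin p × n) n ℝ[X] :=
  Matrix.of fun r b => if r.2 = b then X ^ (r.1 : ℕ) else 0

/-- The shift rows cancel and the last row assembles P. Thus (z - A)⁻¹E_p is the power column times
P⁻¹, and the controller form has transfer function QP⁻¹. -/
lemma charmatrix_companion_mul_powerColumn [Fintype n] [DecidableEq n] (p : ℕ) (A : ℕ → Matrix n n ℝ) :
    (companion p A).charmatrix * powerColumn n p =
      ((controllerInput p).map C : Matrix (Fin p × n) n ℝ[X]) * arPoly p A := by
  ext1 ⟨r, x⟩ b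
  have h1 : (((controllerInput p).map C : Matrix (Fin p × n) n ℝ[X]) * arPoly p A) (r, x) b =
      if (r : ℕ) + 1 = p then arPoly p A x b else 0 := by
    simp only [Matrix.mul_apply, Matrix.map_apply, controllerInput, Matrix.of_apply]
    split_ifs with h <;> simp [h, apply_ite C]
  have h2 : (((companion p A).map C : Matrix (Fin p × n) (Fin p × n) ℝ[X]) *
      powerColumn n p) (r, x) b =
      if (r : ℕ) + 1 < p then (if x = b then (X : ℝ[X]) ^ ((r : ℕ) + 1) else 0)
      else - ∑ c : Fin p, X ^ (c : ℕ) * C (A (p - c) x b) := by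
    rw [Matrix.mul_apply, Fintype.sum_prod_type]
    simp only [Matrix.map_apply, companion, Matrix.of_apply, powerColumn, mul_ite, mul_zero,
      Finset.sum_ite_eq', Finset.mem_univ, if_true]
    split_ifs with h hx
    · subst hx
      rw [Finset.sum_eq_single ⟨(r : ℕ) + 1, h⟩]
      · simp
      · intro c _ hc
        rw [if_neg, C_0, zero_mul]
        rintro ⟨h', -⟩
        exact hc (Fin.ext h')
      · simp
    · simp [hx]
    · rw [← Finset.sum_neg_distrib]
      refine Finset.sum_congr rfl fun c _ => ?_
      rw [C_neg, neg_mul, mul_comm]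
  rw [h1, Matrix.charmatrix, Matrix.sub_mul, Matrix.sub_apply, RingHom.mapMatrix_apply]
  rw [h2]
  rw [Matrix.scalar_apply, Matrix.diagonal_mul]
  simp only [powerColumn, Matrix.of_apply]
  by_cases h : (r : ℕ) + 1 < p
  · rw [if_pos h, if_neg h.ne]
    split_ifs <;> simp [pow_succ']
  · have hp : (r : ℕ) + 1 = p := by have := r.2; omega
    rw [if_neg h, if_pos hp, arPoly_eq_sum_range, Finset.sum_range]
    simp only [Matrix.add_apply, Matrix.smul_apply, Matrix.one_apply, Matrix.sum_apply,
      Matrix.map_apply, smul_eq_mul, mul_ite, mul_one, mul_zero, sub_neg_eq_add, ← pow_succ', hp]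

lemma controllerOutput_mul_powerColumn [Fintype n] [DecidableEq n] {p q : ℕ} (hpq : q < p) (B : ℕ → Matrix k n ℝ) :
    (controllerOutput p q B).map C * powerColumn n p = maPoly q B := by
  ext1 a b
  rw [maPoly_eq_sum_range hpq, Matrix.mul_apply, Fintype.sum_prod_type, Matrix.sum_apply,
    Finset.sum_range]
  refine Finset.sum_congr rfl fun c _ => ?_
  simp only [Matrix.map_apply, controllerOutput, Matrix.of_apply, powerColumn, mul_ite, mul_zero,
    Finset.sum_ite_eq', Finset.mem_univ, if_true, Matrix.smul_apply, smul_eq_mul]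
  rw [mul_comm]
  split_ifs <;> simp

end Algebra

/-! ### Evaluation at complex points, left eigenvectors of the companion matrix, and peeling off
eigenvalues -/

section Evaluation

variable {k n o : Type*}

/-- A real matrix regarded as a complex matrix. -/
noncomputable def complexify (M : Matrix k n ℝ) : Matrix k n ℂ :=
  M.map (algebraMap ℝ ℂ)

lemma complexify_mul [Fintype n] (M : Matrix k n ℝ) (N : Matrix n o ℝ) :
    complexify (M * N) = complexify M * complexify N :=
  Matrix.map_mul (f := algebraMap ℝ ℂ)

lemma evalAt_mul [Fintype n] (M : Matrix k n ℝ[X]) (N : Matrix n o ℝ[X]) (z : ℂ) :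
    evalAt (M * N) z = evalAt M z * evalAt N z :=
  Matrix.map_mul (f := (aeval z : ℝ[X] →ₐ[ℝ] ℂ).toRingHom)

lemma evalAt_add (M N : Matrix k n ℝ[X]) (z : ℂ) :
    evalAt (M + N) z = evalAt M z + evalAt N z :=
  Matrix.map_add _ (map_add _) _ _

lemma evalAt_smul (f : ℝ[X]) (M : Matrix k n ℝ[X]) (z : ℂ) :
    evalAt (f • M) z = aeval z f • evalAt M z := by
  ext1 i j
  simp [evalAt]

lemma evalAt_one [DecidableEq n] (z : ℂ) : evalAt (1 : Matrix n n ℝ[X]) z = 1 :=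
  Matrix.map_one _ (map_zero _) (map_one _)

lemma evalAt_map_C (M : Matrix k n ℝ) (z : ℂ) : evalAt (M.map C) z = complexify M := by
  ext1 i j
  simp [evalAt, complexify]

lemma evalAt_charmatrix [Fintype n] [DecidableEq n] (F : Matrix n n ℝ) (z : ℂ) :
    evalAt F.charmatrix z = z • (1 : Matrix n n ℂ) - complexify F := by
  ext1 i j
  by_cases h : i = j
  · subst h; simp [evalAt, complexify]
  · simp [evalAt, complexify, h]

lemma aeval_charpoly_eq_eval [Fintype n] [DecidableEq n] (F : Matrix n n ℝ) (z : ℂ) :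
    aeval z F.charpoly = (complexify F).charpoly.eval z := by
  rw [complexify, Matrix.charpoly_map, eval_map_algebraMap]

lemma aeval_charpoly_eq_det [Fintype n] [DecidableEq n] (F : Matrix n n ℝ) (z : ℂ) :
    aeval z F.charpoly = (z • (1 : Matrix n n ℂ) - complexify F).det := by
  rw [aeval_charpoly_eq_eval, Matrix.eval_charpoly, Matrix.scalar_apply,
    Matrix.smul_one_eq_diagonal]

/-- Read blockwise from the last block backwards, the eigenvector equation is Horner's recursion, so
the last block v determines all the others. -/
lemma exists_vecMul_hornerRow_eq [Fintype k] [DecidableEq k] {p : ℕ} {A : ℕ → Matrix k k ℝ}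
    {z : ℂ} {l : Fin p × k → ℂ} (hl : l ᵥ* complexify (companion p A) = z • l) :
    ∃ v, l = v ᵥ* evalAt (hornerRow p A) z := by
  obtain _ | p := p
  · exact ⟨0, funext fun c => c.1.elim0⟩
  let v : k → ℂ := fun b => l (Fin.last p, b)
  have hblock : ∀ (c : Fin p) (b : k), l (c.castSucc, b) =
      z * l (c.succ, b) + (v ᵥ* complexify (A (p - c))) b := by
    intro c b
    have h := congrFun hl (c.succ, b)
    simp only [Matrix.vecMul, dotProduct, Pi.smul_apply, smul_eq_mul] at h
    rw [Fintype.sum_prod_type, Fin.sum_univ_castSucc] at h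
    simp only [complexify, Matrix.map_apply, companion, Matrix.of_apply, Fin.val_castSucc,
      Fin.val_last, lt_irrefl, if_false, add_lt_add_iff_right, Fin.is_lt, if_true,
      Fin.val_succ, add_left_inj] at h
    rw [Finset.sum_eq_single c (fun i _ hi => ?_) (by simp)] at h
    · rw [← h]
      simp only [Matrix.vecMul, dotProduct, complexify, Matrix.map_apply, v]
      simp
    · have : (c : ℕ) ≠ i := fun h' => hi (Fin.ext h'.symm)
      simp [this]
  refine ⟨v, ?_⟩
  have key : ∀ (j : ℕ) (c : Fin (p + 1)) (b : k), (c : ℕ) + j = p →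
      l (c, b) = (v ᵥ* evalAt (arPoly j A) z) b := by
    intro j
    induction j with
    | zero =>
      intro c b hc
      rw [arPoly_zero, evalAt_one, Matrix.vecMul_one, show c = Fin.last p from Fin.ext hc]
    | succ j ih =>
      intro c b hc
      have hcp : (c : ℕ) < p := by omega
      have h1 := hblock ⟨c, hcp⟩ b
      rw [show Fin.castSucc ⟨c, hcp⟩ = c from rfl, show p - ((⟨c, hcp⟩ : Fin p) : ℕ) = j + 1 by
        change p - (c : ℕ) = j + 1; omega, ih (Fin.succ ⟨c, hcp⟩) b
        (by change (c : ℕ) + 1 + j = p; omega)] at h1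
      rw [h1, arPoly_succ, evalAt_add, evalAt_smul, evalAt_map_C, aeval_X, Matrix.vecMul_add,
        Matrix.vecMul_smul]
      rfl
  ext1 ⟨c, b⟩
  rw [key (p - c) c b (by have := c.2; omega)]
  rfl

/-- Bridge between the Hautus test for (F, G) and coprimeness of (P, Q): an eigenvector l = vM turns
PH = M(z - F) into vP(z) = 0 and MG = Q into vQ(z) = lG. -/
lemma exists_left_null_of_eigenvector [Fintype k] [DecidableEq k] {p q : ℕ} (hpq : q < p)
    {A : ℕ → Matrix k k ℝ} (B : ℕ → Matrix k n ℝ) {z : ℂ} {l : Fin p × k → ℂ}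
    (hl : l ᵥ* complexify (companion p A) = z • l) (hl0 : l ≠ 0) :
    ∃ v ≠ 0, v ᵥ* evalAt (arPoly p A) z = 0 ∧
      v ᵥ* evalAt (maPoly q B) z = l ᵥ* complexify (observerInput p q A B) := by
  obtain ⟨v, hv⟩ := exists_vecMul_hornerRow_eq hl
  refine ⟨v, ?_, ?_, ?_⟩
  · rintro rfl
    exact hl0 (by rw [hv, Matrix.zero_vecMul])
  · have h := congrArg (fun M => v ᵥ* evalAt M z) (arPoly_mul_observerOutput p A)
    simp only [evalAt_mul, ← Matrix.vecMul_vecMul, ← hv, evalAt_charmatrix, Matrix.vecMul_sub, hl,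
      Matrix.vecMul_smul, Matrix.vecMul_one, sub_self, evalAt_map_C] at h
    ext b
    have hb := congrFun h (⟨0, by omega⟩, b)
    simpa [Matrix.vecMul, dotProduct, complexify, observerOutput, apply_ite] using hb
  · rw [← hornerRow_mul_observerInput hpq A B, evalAt_mul, ← Matrix.vecMul_vecMul, ← hv,
      evalAt_map_C]

/-- Only the zero sets are needed, so left kernels are matched through v ↦ vM and no block
determinant is computed. -/
lemma aeval_charpoly_companion_eq_zero_iff [Fintype k] [DecidableEq k] {p : ℕ} (hp : 0 < p)
    (A : ℕ → Matrix k k ℝ) (z : ℂ) :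
    aeval z (companion p A).charpoly = 0 ↔ (evalAt (arPoly p A) z).det = 0 := by
  rw [aeval_charpoly_eq_det, ← Matrix.exists_vecMul_eq_zero_iff,
    ← Matrix.exists_vecMul_eq_zero_iff]
  constructor
  · rintro ⟨l, hl0, hl⟩
    rw [Matrix.vecMul_sub, sub_eq_zero, Matrix.vecMul_smul, Matrix.vecMul_one] at hl
    -- A dummy moving average polynomial with q = 0; its half of the conclusion is discarded.
    obtain ⟨v, hv0, hv, -⟩ := exists_left_null_of_eigenvector hp (0 : ℕ → Matrix k k ℝ) hl.symm hl0
    exact ⟨v, hv0, hv⟩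
  · rintro ⟨v, hv0, hv⟩
    refine ⟨v ᵥ* evalAt (hornerRow p A) z, fun h => hv0 ?_, ?_⟩
    -- The last block of M is the identity, so vM = 0 forces v = 0.
    · ext b
      have hb := congrFun h (⟨p - 1, by omega⟩, b)
      have h1 : (v ᵥ* evalAt (hornerRow p A) z) (⟨p - 1, by omega⟩, b) =
          (v ᵥ* evalAt (arPoly (p - 1 - (p - 1)) A) z) b := rfl
      rwa [h1, Nat.sub_self, arPoly_zero, evalAt_one, Matrix.vecMul_one] at hb
    · rw [← evalAt_charmatrix, Matrix.vecMul_vecMul, ← evalAt_mul, ← arPoly_mul_observerOutput,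
        evalAt_mul, ← Matrix.vecMul_vecMul, hv, Matrix.zero_vecMul]

lemma LeftCoprime.eq_zero_of_vecMul {d m : ℕ} {P : Matrix (Fin d) (Fin d) ℝ[X]}
    {Q : Matrix (Fin d) (Fin m) ℝ[X]} (h : LeftCoprime P Q) {z : ℂ} {v : Fin d → ℂ}
    (hP : v ᵥ* evalAt P z = 0) (hQ : v ᵥ* evalAt Q z = 0) : v = 0 := by
  have h1 : LinearIndependent ℂ (Matrix.fromCols (evalAt P z) (evalAt Q z)).row := by
    rw [linearIndependent_iff_card_eq_finrank_span, Set.finrank,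
      ← Matrix.rank_eq_finrank_span_row, h z, Fintype.card_fin]
  refine Matrix.vecMul_injective_iff.2 h1 ?_
  beta_reduce
  rw [Matrix.zero_vecMul, Matrix.vecMul_fromCols, hP, hQ]
  ext (i | i) <;> rfl

/-- Backward induction along the roots of the characteristic polynomial. -/
lemma forall_mem_of_charpoly_roots [Fintype n] [DecidableEq n] (F : Matrix n n ℂ)
    {U : Set (n → ℂ)} (hU : ∀ l ∈ U, ∀ z : ℂ, l ᵥ* F - z • l ∈ U) {Z : (n → ℂ) → Prop} (h0 : Z 0)
    (hstep : ∀ l ∈ U, ∀ z : ℂ, F.charpoly.IsRoot z → Z (l ᵥ* F - z • l) → Z l) :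
    ∀ l ∈ U, Z l := by
  have key : ∀ s : Multiset ℂ, (∀ z ∈ s, F.charpoly.IsRoot z) → ∀ l ∈ U,
      l ᵥ* aeval F (s.map fun z => X - C z).prod = 0 → Z l := by
    intro s
    induction s using Multiset.induction with
    | empty =>
      intro _ l _ h
      simp only [Multiset.map_zero, Multiset.prod_zero, map_one, Matrix.vecMul_one] at h
      rwa [h]
    | cons z s ih =>
      intro hs l hl h
      refine hstep l hl z (hs z (Multiset.mem_cons_self z s)) ?_
      refine ih (fun w hw => hs w (Multiset.mem_cons_of_mem hw)) _ (hU l hl z) ?_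
      rw [← h, Multiset.map_cons, Multiset.prod_cons, map_mul, ← Matrix.vecMul_vecMul]
      congr 1
      rw [map_sub, aeval_X, aeval_C, Matrix.vecMul_sub, Algebra.algebraMap_eq_smul_one,
        Matrix.vecMul_smul, Matrix.vecMul_one]
  intro l hl
  -- Over ℂ the product over all roots is the characteristic polynomial, which annihilates every
  -- vector by Cayley–Hamilton.
  refine key F.charpoly.roots (fun z hz => isRoot_of_mem_roots hz) l hl ?_
  rw [← (IsAlgClosed.splits F.charpoly).eq_prod_roots_of_monic F.charpoly_monic,
    Matrix.aeval_self_charpoly, Matrix.vecMul_zero]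

end Evaluation

/-! ### Resolvents at infinity and Markov parameters -/

section Markov

variable {k n ι κ : Type*} [Fintype ι] [DecidableEq ι] [Fintype κ] [DecidableEq κ]

lemma tendsto_smul_inv_smul_one_sub (F : Matrix ι ι ℝ) :
    Tendsto (fun x : ℝ => x • (x • (1 : Matrix ι ι ℝ) - F)⁻¹) atTop (𝓝 1) ∧
      ∀ᶠ x : ℝ in atTop, IsUnit (x • (1 : Matrix ι ι ℝ) - F).det := by
  have h1 : Tendsto (fun x : ℝ => (1 : Matrix ι ι ℝ) - x⁻¹ • F) atTop (𝓝 1) := by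
    simpa using (tendsto_const_nhds (x := (1 : Matrix ι ι ℝ))).sub
      ((tendsto_inv_atTop_zero (𝕜 := ℝ)).smul_const F)
  have hdet : Tendsto (fun x : ℝ => ((1 : Matrix ι ι ℝ) - x⁻¹ • F).det) atTop (𝓝 1) := by
    simpa [Function.comp_def] using ((continuous_id.matrix_det (n := ι) (R := ℝ)).tendsto 1).comp h1
  have hadj : Tendsto (fun x : ℝ => ((1 : Matrix ι ι ℝ) - x⁻¹ • F).adjugate) atTop (𝓝 1) := by
    simpa [Function.comp_def] using
      ((continuous_id.matrix_adjugate (n := ι) (R := ℝ)).tendsto 1).comp h1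
  have hne : ∀ᶠ x : ℝ in atTop, ((1 : Matrix ι ι ℝ) - x⁻¹ • F).det ≠ 0 :=
    hdet.eventually_ne one_ne_zero
  have heq : ∀ x : ℝ, x ≠ 0 →
      x • (1 : Matrix ι ι ℝ) - F = x • ((1 : Matrix ι ι ℝ) - x⁻¹ • F) := by
    intro x hx
    rw [smul_sub, smul_smul, mul_inv_cancel₀ hx, one_smul]
  constructor
  · have h2 : Tendsto (fun x : ℝ => ((1 : Matrix ι ι ℝ) - x⁻¹ • F)⁻¹) atTop (𝓝 1) := by
      simp only [Matrix.inv_def, Ring.inverse_eq_inv']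
      simpa using (hdet.inv₀ one_ne_zero).smul hadj
    refine h2.congr' ?_
    filter_upwards [hne, eventually_ne_atTop 0] with x hx hx0
    refine (Matrix.inv_eq_left_inv ?_)
    have hu : IsUnit (x • (1 : Matrix ι ι ℝ) - F).det := by
      rw [heq x hx0, Matrix.det_smul]
      exact isUnit_iff_ne_zero.2 (mul_ne_zero (pow_ne_zero _ hx0) hx)
    rw [Matrix.smul_mul, ← Matrix.mul_smul, ← heq x hx0, Matrix.nonsing_inv_mul _ hu]
  · filter_upwards [hne, eventually_ne_atTop 0] with x hx hx0
    rw [heq x hx0, Matrix.det_smul]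
    exact isUnit_iff_ne_zero.2 (mul_ne_zero (pow_ne_zero _ hx0) hx)

/-- Equal transfer functions have equal Markov parameters. -/
lemma markov_parameters_eq (F : Matrix ι ι ℝ) (G : Matrix ι n ℝ) (F' : Matrix κ κ ℝ)
    (G' : Matrix κ n ℝ) (j : ℕ) : ∀ (H : Matrix k ι ℝ) (H' : Matrix k κ ℝ),
    (∀ᶠ x : ℝ in atTop, H * (x • (1 : Matrix ι ι ℝ) - F)⁻¹ * G =
      H' * (x • (1 : Matrix κ κ ℝ) - F')⁻¹ * G') →
    H * (F ^ j : Matrix ι ι ℝ) * G = H' * (F' ^ j : Matrix κ κ ℝ) * G' := by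
  have hlim : ∀ (H : Matrix k ι ℝ) (H' : Matrix k κ ℝ),
      (∀ᶠ x : ℝ in atTop, H * (x • (1 : Matrix ι ι ℝ) - F)⁻¹ * G =
      H' * (x • (1 : Matrix κ κ ℝ) - F')⁻¹ * G') → H * G = H' * G' := by
    intro H H' h
    have t1 : Tendsto (fun x : ℝ => H * (x • (x • (1 : Matrix ι ι ℝ) - F)⁻¹) * G) atTop
        (𝓝 (H * (1 : Matrix ι ι ℝ) * G)) :=
      (((continuous_const (y := H)).matrix_mul continuous_id).matrix_mul
        (continuous_const (y := G))).continuousAt.tendsto.comp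
        (tendsto_smul_inv_smul_one_sub F).1
    have t2 : Tendsto (fun x : ℝ => H' * (x • (x • (1 : Matrix κ κ ℝ) - F')⁻¹) * G') atTop
        (𝓝 (H' * (1 : Matrix κ κ ℝ) * G')) :=
      (((continuous_const (y := H')).matrix_mul continuous_id).matrix_mul
        (continuous_const (y := G'))).continuousAt.tendsto.comp
        (tendsto_smul_inv_smul_one_sub F').1
    rw [Matrix.mul_one] at t1 t2
    refine tendsto_nhds_unique t1 (t2.congr' ?_)
    filter_upwards [h] with x hx
    simp only [Matrix.mul_smul, Matrix.smul_mul, hx]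
  induction j with
  | zero => simpa using hlim
  | succ j ih =>
    intro H H' h
    rw [pow_succ', ← Matrix.mul_assoc, pow_succ', ← Matrix.mul_assoc]
    refine ih _ _ ?_
    filter_upwards [h, (tendsto_smul_inv_smul_one_sub F).2,
      (tendsto_smul_inv_smul_one_sub F').2] with x hx hu hu'
    -- Replacing H by HF turns the transfer function into x·H(x - F)⁻¹G - HG. Both terms agree for
    -- the two systems, the second by the limit `hlim`, so the induction hypothesis applies.
    have e1 : F * (x • (1 : Matrix ι ι ℝ) - F)⁻¹ = x • (x • (1 : Matrix ι ι ℝ) - F)⁻¹ - 1 := by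
      nth_rewrite 3 [← Matrix.mul_nonsing_inv _ hu]
      rw [Matrix.sub_mul, Matrix.smul_mul, Matrix.one_mul,
        sub_sub_cancel]
    have e2 : F' * (x • (1 : Matrix κ κ ℝ) - F')⁻¹ = x • (x • (1 : Matrix κ κ ℝ) - F')⁻¹ - 1 := by
      nth_rewrite 3 [← Matrix.mul_nonsing_inv _ hu']
      rw [Matrix.sub_mul, Matrix.smul_mul, Matrix.one_mul,
        sub_sub_cancel]
    rw [Matrix.mul_assoc H, e1, Matrix.mul_assoc H', e2]
    simp only [Matrix.mul_sub, Matrix.sub_mul, Matrix.mul_smul, Matrix.smul_mul, hx,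
      Matrix.mul_one, hlim H H' h]

end Markov

/-! ### The right fraction -/

section Fraction

variable {k n : Type*}

/-- The numerator `χ(z) H adj(z - F) G` of the transfer function `H (z - F)⁻¹ G` with respect to
the denominator `χ(z) ^ 2`, for the observer canonical form with characteristic polynomial `χ`. -/
noncomputable def numerator [Fintype k] [DecidableEq k] (p q : ℕ) (A : ℕ → Matrix k k ℝ) (B : ℕ → Matrix k n ℝ) :
    Matrix k n ℝ[X] :=
  (companion p A).charpoly • (((observerOutput p).map C : Matrix k (Fin p × k) ℝ[X]) *
    (companion p A).charmatrix.adjugate *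
    ((observerInput p q A B).map C : Matrix (Fin p × k) n ℝ[X]))

/-- One factor χ comes from (z - F) adj(z - F) = χ, the other is built into the numerator. -/
lemma arPoly_mul_numerator [Fintype k] [DecidableEq k] {p q : ℕ} (hpq : q < p) (A : ℕ → Matrix k k ℝ)
    (B : ℕ → Matrix k n ℝ) :
    arPoly p A * numerator p q A B = (companion p A).charpoly ^ 2 • maPoly q B := by
  rw [numerator, Matrix.mul_smul, ← Matrix.mul_assoc, ← Matrix.mul_assoc,
    arPoly_mul_observerOutput, Matrix.mul_assoc (hornerRow p A), Matrix.mul_adjugate,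
    ← Matrix.charpoly, Matrix.mul_smul, Matrix.mul_one, Matrix.smul_mul,
    hornerRow_mul_observerInput hpq, smul_smul, pow_two]

lemma coeff_arPoly_apply [Fintype k] [DecidableEq k] (p : ℕ) (A : ℕ → Matrix k k ℝ) (a b : k) :
    (arPoly p A a b).coeff p = (1 : Matrix k k ℝ) a b ∧ (arPoly p A a b).natDegree ≤ p := by
  rw [arPoly_eq_sum_range]
  simp only [Matrix.add_apply, Matrix.smul_apply, Matrix.sum_apply, Matrix.map_apply, smul_eq_mul]
  constructor
  · simp only [coeff_add, finsetSum_coeff, coeff_X_pow_mul', coeff_C]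
    rw [Finset.sum_eq_zero, add_zero]
    · simp only [le_refl, if_true, Nat.sub_self, Matrix.one_apply]
      split_ifs <;> simp
    · intro c hc
      rw [Finset.mem_range] at hc
      rw [if_pos hc.le, if_neg (by omega)]
  · refine (natDegree_add_le _ _).trans (max_le ?_ ?_)
    · rw [Matrix.one_apply]
      split_ifs <;> simp
    · refine natDegree_sum_le_of_forall_le _ _ fun c hc => ?_
      rw [Finset.mem_range] at hc
      exact (natDegree_mul_C_le _ _).trans (by simpa using hc.le)

/-- If `P` is monic of degree `p`, then `deg (P Q) = p + deg Q`. -/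
lemma coeff_arPoly_mul [Fintype k] [DecidableEq k] (p q : ℕ) (A : ℕ → Matrix k k ℝ) (Q : Matrix k n ℝ[X])
    (hq : ∀ a b, (Q a b).natDegree ≤ q) (a : k) (b : n) :
    ((arPoly p A * Q) a b).coeff (p + q) = (Q a b).coeff q := by
  rw [Matrix.mul_apply, finsetSum_coeff]
  have : ∀ c, (arPoly p A a c * Q c b).coeff (p + q) =
      (1 : Matrix k k ℝ) a c * (Q c b).coeff q := by
    intro c
    rw [coeff_mul_add_eq_of_natDegree_le (coeff_arPoly_apply p A a c).2 (hq c b),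
      (coeff_arPoly_apply p A a c).1]
  simp [this, Matrix.one_apply]

lemma natDegree_maPoly_apply_le (q : ℕ) (B : ℕ → Matrix k n ℝ) (a : k) (b : n) :
    (maPoly q B a b).natDegree ≤ q := by
  rw [maPoly, Matrix.sum_apply]
  refine natDegree_sum_le_of_forall_le _ _ fun c hc => ?_
  rw [Finset.mem_range] at hc
  exact (natDegree_mul_C_le _ _).trans (by simpa using Nat.lt_succ_iff.1 hc)

lemma charpoly_dvd_numerator [Fintype k] [DecidableEq k] (p q : ℕ) (A : ℕ → Matrix k k ℝ)
    (B : ℕ → Matrix k n ℝ) (a : k) (b : n) :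
    (companion p A).charpoly ∣ numerator p q A B a b := by
  rw [numerator, Matrix.smul_apply, smul_eq_mul]
  exact dvd_mul_right _ _

lemma exists_coeff_numerator [Fintype k] [DecidableEq k] [Fintype n] {p q : ℕ}
    (hk : 0 < Fintype.card k) (hpq : q < p) (A : ℕ → Matrix k k ℝ) (B : ℕ → Matrix k n ℝ) :
    ∃ r, 0 < r ∧ r < 2 * (p * Fintype.card k) ∧
      (∀ a b, (numerator p q A B a b).natDegree ≤ r) ∧
      (maPoly q B ≠ 0 → ∃ a b, (numerator p q A B a b).coeff r ≠ 0) := by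
  obtain ⟨Q, hQ⟩ : ∃ Q, Q = numerator p q A B := ⟨_, rfl⟩
  obtain ⟨χ, hχ⟩ : ∃ χ, χ = (companion p A).charpoly := ⟨_, rfl⟩
  rw [← hQ]
  have hmonic : χ.Monic := hχ ▸ Matrix.charpoly_monic _
  have hdeg : χ.natDegree = p * Fintype.card k := by
    rw [hχ, Matrix.charpoly_natDegree_eq_dim, Fintype.card_prod, Fintype.card_fin]
  have hN : 0 < p * Fintype.card k := Nat.mul_pos (by omega) hk
  have hPQ : arPoly p A * Q = χ ^ 2 • maPoly q B := by
    rw [hQ, hχ, arPoly_mul_numerator hpq A B]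
  by_cases h0 : Q = 0
  -- For Q = 0 any admissible degree serves; the last clause is vacuous because χ² ≠ 0 then forces
  -- Q̃ = 0.
  · refine ⟨1, one_pos, by omega, by simp [h0], fun hB => absurd ?_ hB⟩
    rw [h0, Matrix.mul_zero] at hPQ
    ext1 a b
    have h := congrFun (congrFun hPQ a) b
    rw [Matrix.smul_apply, smul_eq_mul, Matrix.zero_apply, eq_comm, mul_eq_zero] at h
    rw [Matrix.zero_apply]
    exact h.resolve_left (hmonic.pow 2).ne_zero
  · let r := Finset.univ.sup fun ab : k × n => (Q ab.1 ab.2).natDegree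
    have hle : ∀ a b, (Q a b).natDegree ≤ r := fun a b =>
      Finset.le_sup (f := fun ab : k × n => (Q ab.1 ab.2).natDegree) (b := (a, b))
        (Finset.mem_univ _)
    obtain ⟨a₀, b₀, hab₀⟩ : ∃ a b, Q a b ≠ 0 := by
      by_contra! h
      exact h0 (Matrix.ext h)
    -- The purpose of the extra factor χ: it divides a nonzero entry, so the degree is at least deg
    -- χ > 0.
    have hpos : p * Fintype.card k ≤ r := by
      refine le_trans ?_ (hle a₀ b₀)
      rw [← hdeg]
      have hdvd : χ ∣ Q a₀ b₀ := by
        rw [hQ, hχ]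
        exact charpoly_dvd_numerator p q A B a₀ b₀
      exact natDegree_le_of_dvd hdvd hab₀
    obtain ⟨⟨a, b⟩, -, hr⟩ := Finset.exists_mem_eq_sup (Finset.univ : Finset (k × n))
      ⟨(a₀, b₀), Finset.mem_univ _⟩ fun ab : k × n => (Q ab.1 ab.2).natDegree
    have hr : r = (Q a b).natDegree := hr
    have hc : (Q a b).coeff r ≠ 0 := by
      rw [hr]
      refine leadingCoeff_ne_zero.2 fun h => ?_
      rw [h, natDegree_zero] at hr
      omega
    refine ⟨r, by omega, ?_, hle, fun _ => ⟨a, b, hc⟩⟩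
    -- Since P is monic, p + r is at most deg(χ²Q̃) ≤ 2 deg χ + q, and q < p gives r < 2 deg χ.
    have h1 := coeff_arPoly_mul p r A Q hle a b
    rw [hPQ, Matrix.smul_apply, smul_eq_mul] at h1
    have h2 : p + r ≤ (χ ^ 2 * maPoly q B a b).natDegree :=
      le_natDegree_of_ne_zero (by rwa [h1])
    have h3 := natDegree_mul_le (p := χ ^ 2) (q := maPoly q B a b)
    rw [natDegree_pow, hdeg] at h3
    have h4 := natDegree_maPoly_apply_le q B a b
    omega

/-- The scalar matrix polynomial `g • 1` as a monic matrix polynomial. -/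
lemma arPoly_scalar [DecidableEq n] {g : ℝ[X]} (hg : g.Monic) :
    arPoly g.natDegree (fun i => g.coeff (g.natDegree - i) • (1 : Matrix n n ℝ)) =
      g • (1 : Matrix n n ℝ[X]) := by
  rw [arPoly_eq_sum_range]
  conv_rhs => rw [hg.as_sum]
  rw [add_smul, Finset.sum_smul]
  congr 1
  refine Finset.sum_congr rfl fun c hc => ?_
  rw [Finset.mem_range] at hc
  ext1 a b
  simp only [Nat.sub_sub_self hc.le, Matrix.smul_apply, Matrix.map_apply, smul_eq_mul,
    Matrix.one_apply]
  split_ifs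
  · rw [mul_one, mul_one, mul_comm]
  · simp

lemma maPoly_coeff {r : ℕ} {Q : Matrix k n ℝ[X]} (hr : ∀ a b, (Q a b).natDegree ≤ r) :
    maPoly r (fun j => Q.map fun f => f.coeff j) = Q := by
  ext1 a b
  rw [maPoly, Matrix.sum_apply]
  conv_rhs => rw [(Q a b).as_sum_range' (r + 1) (Nat.lt_succ_iff.2 (hr a b))]
  refine Finset.sum_congr rfl fun c _ => ?_
  simp only [Matrix.smul_apply, Matrix.map_apply, smul_eq_mul]
  rw [← C_mul_X_pow_eq_monomial, mul_comm]

end Fraction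

/-! ### Càdlàg paths -/

section Cadlag

variable {E G : Type*}

lemma IsCadlag.comp_continuous [TopologicalSpace E] [TopologicalSpace G] {f : ℝ → E}
    (hf : IsCadlag f) {g : E → G} (hg : Continuous g) : IsCadlag fun t => g (f t) := by
  intro t
  obtain ⟨h1, l, h2⟩ := hf t
  exact ⟨hg.continuousAt.comp_continuousWithinAt h1, g l, (hg.tendsto l).comp h2⟩

lemma IsCadlag.prodMk [TopologicalSpace E] [TopologicalSpace G] {f : ℝ → E} {g : ℝ → G}
    (hf : IsCadlag f) (hg : IsCadlag g) : IsCadlag fun t => (f t, g t) := by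
  intro t
  obtain ⟨h1, l, h2⟩ := hf t
  obtain ⟨h1', l', h2'⟩ := hg t
  exact ⟨h1.prodMk h1', (l, l'), h2.prodMk_nhds h2'⟩

lemma isCadlag_of_continuous [TopologicalSpace E] {f : ℝ → E} (hf : Continuous f) :
    IsCadlag f := fun t =>
  ⟨hf.continuousWithinAt, f t, hf.continuousAt.tendsto.mono_left nhdsWithin_le_nhds⟩

lemma IsCadlag.exists_norm_le [NormedAddCommGroup E] {f : ℝ → E} (hf : IsCadlag f) (a b : ℝ) :
    ∃ M, ∀ u ∈ Set.Icc a b, ‖f u‖ ≤ M := by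
  refine isCompact_Icc.induction_on (p := fun s => ∃ M, ∀ u ∈ s, ‖f u‖ ≤ M) ⟨0, by simp⟩
    (fun s t hst ⟨M, hM⟩ => ⟨M, fun u hu => hM u (hst hu)⟩) ?_ ?_
  · rintro s t ⟨M, hM⟩ ⟨N, hN⟩
    refine ⟨max M N, ?_⟩
    rintro u (hu | hu)
    · exact (hM u hu).trans (le_max_left _ _)
    · exact (hN u hu).trans (le_max_right _ _)
  · intro t _
    obtain ⟨h1, l, h2⟩ := hf t
    have e1 : ∀ᶠ u in 𝓝[≥] t, ‖f u‖ ≤ max (‖f t‖ + 1) (‖l‖ + 1) := by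
      filter_upwards [h1.norm.eventually_lt_const (lt_add_one ‖f t‖)] with u hu
      exact hu.le.trans (le_max_left _ _)
    have e2 : ∀ᶠ u in 𝓝[<] t, ‖f u‖ ≤ max (‖f t‖ + 1) (‖l‖ + 1) := by
      filter_upwards [h2.norm.eventually_lt_const (lt_add_one ‖l‖)] with u hu
      exact hu.le.trans (le_max_right _ _)
    have e3 : ∀ᶠ u in 𝓝 t, ‖f u‖ ≤ max (‖f t‖ + 1) (‖l‖ + 1) := by
      rw [← nhdsLT_sup_nhdsGE, eventually_sup]
      exact ⟨e2, e1⟩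
    exact ⟨_, mem_nhdsWithin_of_mem_nhds e3, _, fun u hu => hu⟩

/-- A process with right-continuous paths is jointly measurable. -/
lemma measurable_uncurry_of_right_continuous {Ω : Type*} [MeasurableSpace Ω] [TopologicalSpace E]
    [TopologicalSpace.PseudoMetrizableSpace E] [MeasurableSpace E] [BorelSpace E]
    {X : ℝ → Ω → E} (hX : ∀ t, Measurable (X t))
    (hr : ∀ ω t, ContinuousWithinAt (fun t => X t ω) (Set.Ici t) t) :
    Measurable (Function.uncurry X) := by
  -- Grid points approaching u from the right. They depend on u only through an integer, so each
  -- approximating process is jointly measurable by countability.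
  let a : ℕ → ℝ → ℝ := fun k u => ((⌊((k : ℝ) + 1) * u⌋ : ℝ) + 1) / ((k : ℝ) + 1)
  have ha1 : ∀ k u, u ≤ a k u := by
    intro k u
    rw [le_div_iff₀ (by positivity), mul_comm]
    exact (Int.lt_floor_add_one _).le
  have ha2 : ∀ k u, a k u ≤ u + 1 / ((k : ℝ) + 1) := by
    intro k u
    have hk : (0 : ℝ) < (k : ℝ) + 1 := by positivity
    rw [div_le_iff₀ hk, add_mul u, one_div, inv_mul_cancel₀ hk.ne', mul_comm u]
    gcongr
    exact Int.floor_le _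
  have ha : ∀ u, Tendsto (fun k => a k u) atTop (𝓝[≥] u) := by
    intro u
    refine tendsto_nhdsWithin_iff.2 ⟨?_, Eventually.of_forall fun k => ha1 k u⟩
    refine tendsto_of_tendsto_of_tendsto_of_le_of_le tendsto_const_nhds ?_
      (fun k => ha1 k u) (fun k => ha2 k u)
    simpa using tendsto_const_nhds.add (tendsto_one_div_add_atTop_nhds_zero_nat (𝕜 := ℝ))
  refine measurable_of_tendsto_metrizable (f := fun k (q : ℝ × Ω) => X (a k q.1) q.2) ?_ ?_
  · intro k
    have h1 : Measurable fun q : ℤ × Ω => X (((q.1 : ℝ) + 1) / ((k : ℝ) + 1)) q.2 :=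
      measurable_from_prod_countable_right fun j => hX (((j : ℝ) + 1) / ((k : ℝ) + 1))
    have h2 : Measurable fun q : ℝ × Ω => (⌊((k : ℝ) + 1) * q.1⌋, q.2) :=
      (measurable_fst.const_mul _).floor.prodMk measurable_snd
    exact h1.comp h2
  · rw [tendsto_pi_nhds]
    rintro ⟨u, ω⟩
    exact (hr ω u).tendsto.comp (ha u)

lemma IsCadlag.measurable [TopologicalSpace E] [TopologicalSpace.PseudoMetrizableSpace E]
    [MeasurableSpace E] [BorelSpace E] {f : ℝ → E} (hf : IsCadlag f) : Measurable f :=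
  (measurable_uncurry_of_right_continuous (X := fun t (_ : Unit) => f t)
    (fun _ => measurable_const) (fun _ t => (hf t).1)).comp
    (measurable_id.prodMk (measurable_const (a := ())))

lemma IsCadlag.intervalIntegrable [NormedAddCommGroup E] [SecondCountableTopology E]
    {f : ℝ → E} (hf : IsCadlag f) (a b : ℝ) : IntervalIntegrable f volume a b := by
  borelize E
  obtain ⟨M, hM⟩ := hf.exists_norm_le (min a b) (max a b)
  rw [intervalIntegrable_iff]
  refine Measure.integrableOn_of_bounded (M := M) (by simp [Set.uIoc])
    hf.measurable.aestronglyMeasurable ?_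
  refine (ae_restrict_iff' measurableSet_uIoc).2 (Eventually.of_forall fun u hu => hM u ?_)
  exact Set.Ioc_subset_Icc_self hu

end Cadlag

/-! ### Linear differential equations with càdlàg input -/

section ODE

variable {E : Type*} [NormedAddCommGroup E] [NormedSpace ℝ E]

/-- The solution of `w' = T (w + b)` with initial value `w₀` (variation of constants). -/
noncomputable def variationOfConstants (T : E →L[ℝ] E) (b : ℝ → E) (w₀ : E) (t : ℝ) : E :=
  NormedSpace.exp (t • T) (w₀ + ∫ u in (0 : ℝ)..t, NormedSpace.exp (u • (-T)) (T (b u)))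

lemma variationOfConstants_zero (T : E →L[ℝ] E) (b : ℝ → E) (w₀ : E) :
    variationOfConstants T b w₀ 0 = w₀ := by
  simp [variationOfConstants]

lemma continuous_exp_smul [CompleteSpace E] (T : E →L[ℝ] E) : Continuous fun t : ℝ => NormedSpace.exp (t • T) :=
  continuous_iff_continuousAt.2 fun t => (hasDerivAt_exp_smul_const T t).continuousAt

lemma exp_smul_apply_exp_smul_neg [CompleteSpace E] (T : E →L[ℝ] E) (t : ℝ) (x : E) :
    NormedSpace.exp (t • T) (NormedSpace.exp (t • (-T)) x) = x := by
  let : NormedAlgebra ℚ (E →L[ℝ] E) := NormedAlgebra.restrictScalars ℚ ℝ _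
  change (NormedSpace.exp (t • T) * NormedSpace.exp (t • (-T))) x = x
  rw [smul_neg,
    ← NormedSpace.exp_add_of_commute (Commute.refl (t • T)).neg_right, add_neg_cancel,
    NormedSpace.exp_zero]
  rfl

lemma isCadlag_integrand [CompleteSpace E] (T : E →L[ℝ] E) {b : ℝ → E} (hb : IsCadlag b) :
    IsCadlag fun u : ℝ => NormedSpace.exp (u • (-T)) (T (b u)) :=
  ((isCadlag_of_continuous (continuous_exp_smul (-T))).prodMk hb).comp_continuous
    (g := fun q : (E →L[ℝ] E) × E => q.1 (T q.2)) (by fun_prop)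

/-- The input b is only right-continuous, so w has merely a right derivative everywhere; continuity
of w and integrability of that derivative suffice for the fundamental theorem of calculus. -/
lemma variationOfConstants_spec [CompleteSpace E] [SecondCountableTopology E] (T : E →L[ℝ] E) {b : ℝ → E} (hb : IsCadlag b) (w₀ : E) :
    Continuous (variationOfConstants T b w₀) ∧ ∀ s t, variationOfConstants T b w₀ t -
      variationOfConstants T b w₀ s = ∫ u in s..t, T (variationOfConstants T b w₀ u + b u) := by
  have hc := isCadlag_integrand T hb
  have hI : Continuous fun t : ℝ => ∫ u in (0 : ℝ)..t, NormedSpace.exp (u • (-T)) (T (b u)) :=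
    intervalIntegral.continuous_primitive hc.intervalIntegrable 0
  have hw : Continuous (variationOfConstants T b w₀) :=
    (continuous_exp_smul T).clm_apply (continuous_const.add hI)
  refine ⟨hw, fun s t => ?_⟩
  have hint : IsCadlag fun u => T (variationOfConstants T b w₀ u + b u) :=
    ((isCadlag_of_continuous hw).prodMk hb).comp_continuous
      (g := fun q : E × E => T (q.1 + q.2)) (by fun_prop)
  refine (intervalIntegral.integral_eq_sub_of_hasDeriv_right hw.continuousOn (fun u _ => ?_)
    (hint.intervalIntegrable s t)).symm
  borelize E
  have h1 : HasDerivWithinAt (fun t : ℝ => ∫ u in (0 : ℝ)..t,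
      NormedSpace.exp (u • (-T)) (T (b u))) (NormedSpace.exp (u • (-T)) (T (b u))) (Set.Ioi u) u :=
    (intervalIntegral.integral_hasDerivWithinAt_right (s := Set.Ici u) (t := Set.Ioi u)
      (hc.intervalIntegrable 0 u) (hc.measurable.stronglyMeasurable.stronglyMeasurableAtFilter)
      ((hc u).1.mono Set.Ioi_subset_Ici_self)).mono Set.Ioi_subset_Ici_self
  have h2 := (hasDerivAt_exp_smul_const' T u).hasDerivWithinAt (s := Set.Ioi u) |>.clm_apply
    (h1.const_add w₀)
  refine HasDerivWithinAt.congr_deriv (f' := _) h2 ?_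
  rw [exp_smul_apply_exp_smul_neg]
  exact (map_add T (variationOfConstants T b w₀ u) (b u)).symm

lemma measurable_variationOfConstants [CompleteSpace E] [SecondCountableTopology E] {Ω : Type*} [MeasurableSpace Ω] [MeasurableSpace E]
    [BorelSpace E] (T : E →L[ℝ] E) {b : ℝ → Ω → E} (hb : Measurable (Function.uncurry b))
    {w₀ : Ω → E} (hw₀ : Measurable w₀) (t : ℝ) :
    Measurable fun ω => variationOfConstants T (fun u => b u ω) (w₀ ω) t := by
  have h1 : Measurable fun q : Ω × ℝ => NormedSpace.exp (q.2 • (-T)) (T (b q.2 q.1)) := by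
    have h2 : Continuous fun q : ℝ × E => NormedSpace.exp (q.1 • (-T)) (T q.2) :=
      ((continuous_exp_smul (-T)).comp continuous_fst).clm_apply (T.continuous.comp continuous_snd)
    exact h2.measurable.comp (measurable_snd.prodMk (hb.comp measurable_swap))
  have h3 : ∀ ν : Measure ℝ, [SFinite ν] → Measurable fun ω =>
      ∫ u, NormedSpace.exp (u • (-T)) (T (b u ω)) ∂ν := fun ν _ =>
    (h1.stronglyMeasurable.integral_prod_right (ν := ν)).measurable
  have h4 : Measurable fun ω => w₀ ω + ∫ u in (0 : ℝ)..t,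
      NormedSpace.exp (u • (-T)) (T (b u ω)) := by
    simp only [intervalIntegral]
    exact hw₀.add ((h3 _).sub (h3 _))
  exact (NormedSpace.exp (t • T)).continuous.measurable.comp h4

/-- Bootstrapping: integrability makes ξ continuous, hence differentiable with ξ' = zξ, and then
exp(-tz)ξ(t) is constant. -/
lemma eq_exp_mul_of_integral_eq {ξ : ℝ → ℂ} (hξ : ∀ a b, IntervalIntegrable ξ volume a b) (z : ℂ)
    (h : ∀ s t, s ≤ t → ξ t - ξ s = ∫ u in s..t, z * ξ u) (t : ℝ) :
    ξ t = Complex.exp (t * z) * ξ 0 := by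
  have h1 : ∀ t, ξ t = ξ 0 + ∫ u in (0 : ℝ)..t, z * ξ u := by
    intro t
    rcases le_total 0 t with ht | ht
    · rw [← h 0 t ht]; ring
    · rw [intervalIntegral.integral_symm, ← h t 0 ht]; ring
  have hi : ∀ a b, IntervalIntegrable (fun u => z * ξ u) volume a b := fun a b =>
    (hξ a b).const_mul z
  have hcont : Continuous ξ := by
    rw [show ξ = fun t => ξ 0 + ∫ u in (0 : ℝ)..t, z * ξ u from funext h1]
    exact continuous_const.add (intervalIntegral.continuous_primitive hi 0)
  have hd : ∀ t, HasDerivAt ξ (z * ξ t) t := by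
    intro t
    have : HasDerivAt (fun t => ξ 0 + ∫ u in (0 : ℝ)..t, z * ξ u) (z * ξ t) t :=
      ((continuous_const.mul hcont).integral_hasStrictDerivAt 0 t).hasDerivAt.const_add _
    rwa [← show ξ = fun t => ξ 0 + ∫ u in (0 : ℝ)..t, z * ξ u from funext h1] at this
  have hd2 : ∀ t : ℝ, HasDerivAt (fun t : ℝ => Complex.exp (-(t * z)) * ξ t) 0 t := by
    intro t
    have e1 : HasDerivAt (fun t : ℝ => Complex.exp (-(t * z)))
        (Complex.exp (-(t * z)) * -(1 * z)) t :=
      (((Complex.ofRealCLM.hasDerivAt (x := t)).mul_const z).neg).cexp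
    refine (e1.mul (hd t)).congr_deriv ?_
    ring
  have hconst := is_const_of_deriv_eq_zero (fun t => (hd2 t).differentiableAt)
    (fun t => (hd2 t).deriv) t 0
  simp only [Complex.ofReal_zero, zero_mul, neg_zero, Complex.exp_zero, one_mul] at hconst
  rw [← hconst, ← mul_assoc, ← Complex.exp_add, add_neg_cancel, Complex.exp_zero, one_mul]

end ODE

/-! ### Linear functionals of solutions -/

section Pairing

variable {ι κ n : Type*} [Fintype ι] [Fintype κ]

/-- The real-linear functional `x ↦ ∑ i, l i * x i` with complex coefficients. -/
noncomputable def pairing (l : ι → ℂ) : (ι → ℝ) →L[ℝ] ℂ :=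
  ∑ i, (ContinuousLinearMap.proj (R := ℝ) (φ := fun _ : ι => ℝ) i).smulRight (l i)

lemma pairing_apply (l : ι → ℂ) (x : ι → ℝ) : pairing l x = ∑ i, l i * (x i : ℂ) := by
  simp [pairing, mul_comm]

lemma pairing_mulVec (l : κ → ℂ) (M : Matrix κ ι ℝ) (x : ι → ℝ) :
    pairing l (M *ᵥ x) = pairing (l ᵥ* complexify M) x := by
  simp only [pairing_apply, Matrix.mulVec, Matrix.vecMul, dotProduct, complexify,
    Matrix.map_apply, Complex.ofReal_sum, Complex.ofReal_mul, Finset.mul_sum, Finset.sum_mul]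
  rw [Finset.sum_comm]
  simp [mul_assoc]

lemma pairing_sub_smul (l l' : ι → ℂ) (z : ℂ) (x : ι → ℝ) :
    pairing (l - z • l') x = pairing l x - z * pairing l' x := by
  simp only [pairing_apply, Pi.sub_apply, Pi.smul_apply, smul_eq_mul, sub_mul,
    Finset.sum_sub_distrib, Finset.mul_sum, mul_assoc]

lemma pairing_zero (x : ι → ℝ) : pairing 0 x = 0 := by
  simp [pairing_apply]

lemma pairing_ofReal (r x : ι → ℝ) : pairing (fun i => (r i : ℂ)) x = ((r ⬝ᵥ x : ℝ) : ℂ) := by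
  simp [pairing_apply, dotProduct]

lemma pairing_sumElim (l : ι → ℂ) (l' : κ → ℂ) (x : ι → ℝ) (x' : κ → ℝ) :
    pairing (Sum.elim l l') (Sum.elim x x') = pairing l x + pairing l' x' := by
  simp [pairing_apply]

end Pairing

/-! ### Pathwise solutions, reachable subspaces and equality of outputs -/

section PathSolution

variable {ι κ n k : Type*} [Fintype ι] [Fintype κ]

/-- `x` is a càdlàg solution of `dx(t) = F x(t) dt + G dl(t)`. -/
structure IsPathSolution [Fintype n] (F : Matrix ι ι ℝ) (G : Matrix ι n ℝ) (l : ℝ → n → ℝ) (x : ℝ → ι → ℝ) :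
    Prop where
  cadlag : IsCadlag x
  state : ∀ s t : ℝ, s ≤ t → x t - x s = (∫ u in s..t, F *ᵥ x u) + G *ᵥ (l t - l s)

variable {F : Matrix ι ι ℝ} {G : Matrix ι n ℝ} {F' : Matrix κ κ ℝ} {G' : Matrix κ n ℝ}
  {l : ℝ → n → ℝ} {x : ℝ → ι → ℝ} {x' : ℝ → κ → ℝ}

lemma IsPathSolution.isCadlag_mulVec [Fintype n] (h : IsPathSolution F G l x) :
    IsCadlag fun t => F *ᵥ x t :=
  h.cadlag.comp_continuous (g := fun y => F *ᵥ y) (by fun_prop)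

/-- The condition rG = 0 removes the input and r(F - z) = 0 along the path leaves the scalar
equation ξ' = zξ. -/
lemma IsPathSolution.pairing_eq_exp_mul [Fintype n] (h : IsPathSolution F G l x) {r : ι → ℂ} {z : ℂ}
    (hG : r ᵥ* complexify G = 0) (hr : ∀ t, pairing (r ᵥ* complexify F - z • r) (x t) = 0)
    (t : ℝ) : pairing r (x t) = Complex.exp (t * z) * pairing r (x 0) := by
  refine eq_exp_mul_of_integral_eq (ξ := fun t => pairing r (x t))
    (h.cadlag.comp_continuous (pairing r).continuous).intervalIntegrable z (fun s t hst => ?_) t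
  rw [← map_sub, h.state s t hst, map_add, pairing_mulVec r G, hG, pairing_zero, add_zero,
    ← ContinuousLinearMap.intervalIntegral_comp_comm _ (h.isCadlag_mulVec.intervalIntegrable s t)]
  refine intervalIntegral.integral_congr fun u _ => ?_
  have := hr u
  rw [pairing_sub_smul, sub_eq_zero] at this
  simp only [pairing_mulVec, this]

lemma intervalIntegral_apply {f : ℝ → ι → ℝ} {s t : ℝ} (hf : IntervalIntegrable f volume s t)
    (i : ι) : (∫ u in s..t, f u) i = ∫ u in s..t, f u i :=
  (ContinuousLinearMap.intervalIntegral_comp_comm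
    (ContinuousLinearMap.proj (R := ℝ) (φ := fun _ : ι => ℝ) i) hf).symm

/-- The joint system of two systems with the same input. -/
lemma IsPathSolution.sumElim [Fintype n] (h : IsPathSolution F G l x) (h' : IsPathSolution F' G' l x') :
    IsPathSolution (Matrix.fromBlocks F 0 0 F') (Matrix.fromRows G G') l
      fun t => Sum.elim (x t) (x' t) := by
  have hcad : IsCadlag fun t => Sum.elim (x t) (x' t) :=
    (h.cadlag.prodMk h'.cadlag).comp_continuous
      (g := fun q : (ι → ℝ) × (κ → ℝ) => Sum.elim q.1 q.2) (by
        refine continuous_pi ?_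
        rintro (i | i)
        · exact (continuous_apply i).comp continuous_fst
        · exact (continuous_apply i).comp continuous_snd)
  have hm : ∀ u, Matrix.fromBlocks F 0 0 F' *ᵥ Sum.elim (x u) (x' u) =
      Sum.elim (F *ᵥ x u) (F' *ᵥ x' u) := by
    intro u
    simp [Matrix.fromBlocks_mulVec]
  refine ⟨hcad, fun s t hst => ?_⟩
  have hi : IntervalIntegrable (fun u => Sum.elim (F *ᵥ x u) (F' *ᵥ x' u)) volume s t := by
    simp only [← hm]
    exact (hcad.comp_continuous (g := fun y => Matrix.fromBlocks F 0 0 F' *ᵥ y)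
      (by fun_prop)).intervalIntegrable s t
  simp only [hm]
  ext (i | i)
  · have := congrFun (h.state s t hst) i
    rw [Pi.add_apply, intervalIntegral_apply (h.isCadlag_mulVec.intervalIntegrable s t)] at this
    rw [Pi.add_apply, intervalIntegral_apply hi, Matrix.fromRows_mulVec]
    exact this
  · have := congrFun (h'.state s t hst) i
    rw [Pi.add_apply, intervalIntegral_apply (h'.isCadlag_mulVec.intervalIntegrable s t)] at this
    rw [Pi.add_apply, intervalIntegral_apply hi, Matrix.fromRows_mulVec]
    exact this

variable [DecidableEq ι] [DecidableEq κ]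

/-- The row vectors which annihilate the reachable subspace of `(F, G)`. -/
def reachableAnnihilator (F : Matrix ι ι ℝ) (G : Matrix ι n ℝ) : Set (ι → ℂ) :=
  {r | ∀ j : ℕ, r ᵥ* complexify (F ^ j * G) = 0}

lemma reachableAnnihilator_shift {r : ι → ℂ} (hr : r ∈ reachableAnnihilator F G) (z : ℂ) :
    r ᵥ* complexify F - z • r ∈ reachableAnnihilator F G := by
  intro j
  rw [Matrix.sub_vecMul, Matrix.smul_vecMul, hr j, smul_zero, sub_zero, Matrix.vecMul_vecMul,
    ← complexify_mul, ← Matrix.mul_assoc, ← pow_succ', hr (j + 1)]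

lemma vecMul_eq_zero_of_mem_reachableAnnihilator {r : ι → ℂ}
    (hr : r ∈ reachableAnnihilator F G) : r ᵥ* complexify G = 0 := by
  simpa using hr 0

variable [Fintype n]

/-- The map `v ↦ ∑ j, F ^ j G v j`, whose range is the reachable subspace. -/
noncomputable def reach (F : Matrix ι ι ℝ) (G : Matrix ι n ℝ) :
    (ℕ →₀ (n → ℝ)) →ₗ[ℝ] (ι → ℝ) :=
  Finsupp.lsum ℝ fun j => (F ^ j * G).mulVecLin

lemma reach_apply (F : Matrix ι ι ℝ) (G : Matrix ι n ℝ) (v : ℕ →₀ (n → ℝ)) :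
    reach F G v = ∑ j ∈ v.support, (F ^ j * G) *ᵥ v j := by
  simp [reach, Finsupp.sum]

lemma reach_single (F : Matrix ι ι ℝ) (G : Matrix ι n ℝ) (j : ℕ) (w : n → ℝ) :
    reach F G (Finsupp.single j w) = (F ^ j * G) *ᵥ w := by
  simp [reach]

/-- The reachable subspace is the kernel of a matrix whose rows annihilate it. -/
lemma exists_matrix_ker_eq_range_reach (F : Matrix ι ι ℝ) (G : Matrix ι n ℝ) :
    ∃ K : Matrix ι ι ℝ, (∀ i, (fun j => ((K i j : ℝ) : ℂ)) ∈ reachableAnnihilator F G) ∧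
      ∀ x, K *ᵥ x = 0 → x ∈ LinearMap.range (reach F G) := by
  classical
  obtain ⟨W, hW⟩ := (LinearMap.range (reach F G)).exists_isCompl
  -- Projection onto a complement along the reachable subspace: its kernel is that subspace, so its
  -- rows annihilate every Fʲ G.
  let π : (ι → ℝ) →ₗ[ℝ] (ι → ℝ) := W.subtype ∘ₗ W.projectionOnto _ hW.symm
  have hker : ∀ x, π x = 0 ↔ x ∈ LinearMap.range (reach F G) := by
    intro x
    rw [← LinearMap.mem_ker, LinearMap.ker_comp, Submodule.ker_subtype, Submodule.comap_bot,
      Submodule.ker_projectionOnto]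
  have hmul : ∀ x, LinearMap.toMatrix' π *ᵥ x = π x := fun x => by
    rw [← Matrix.toLin'_apply, Matrix.toLin'_toMatrix']
  refine ⟨LinearMap.toMatrix' π, fun i j => ?_, fun x hx => (hker x).1 (by rw [← hmul, hx])⟩
  have h0 : LinearMap.toMatrix' π * (F ^ j * G) = 0 := by
    refine Matrix.ext_of_mulVec_single fun b => ?_
    rw [← Matrix.mulVec_mulVec, hmul, Matrix.zero_mulVec, hker]
    exact ⟨_, reach_single F G j _⟩
  ext b
  have := congrArg (fun M => ((M i b : ℝ) : ℂ)) h0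
  simpa [Matrix.mul_apply, Matrix.vecMul, dotProduct, complexify] using this

/-- A linear choice of initial values with equal coordinates with respect to `F ^ j G` and
`F' ^ j G'`. -/
lemma exists_linearMap_reach (F : Matrix ι ι ℝ) (G : Matrix ι n ℝ) (F' : Matrix κ κ ℝ)
    (G' : Matrix κ n ℝ) : ∃ T : (ι → ℝ) →ₗ[ℝ] (κ → ℝ), ∀ x ∈ LinearMap.range (reach F G),
      ∃ v, x = reach F G v ∧ T x = reach F' G' v := by
  -- Coordinates v are not unique, but a linear section chooses them linearly. Hence T is linear,
  -- and the new initial value stays measurable.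
  obtain ⟨σ, hσ⟩ := (reach F G).rangeRestrict.exists_rightInverse_of_surjective
    (LinearMap.range_rangeRestrict _)
  obtain ⟨T, hT⟩ := (reach F' G' ∘ₗ σ).exists_extend
  refine ⟨T, fun x hx => ⟨σ ⟨x, hx⟩, ?_, ?_⟩⟩
  · have := LinearMap.congr_fun hσ ⟨x, hx⟩
    exact (congrArg Subtype.val this).symm
  · exact LinearMap.congr_fun hT ⟨x, hx⟩

/-- Two systems with the same input and the same Markov parameters, started in corresponding
reachable states, have the same output. -/
lemma IsPathSolution.output_eq [Fintype k] (h : IsPathSolution F G l x)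
    (h' : IsPathSolution F' G' l x') {H : Matrix k ι ℝ} {H' : Matrix k κ ℝ}
    (hmarkov : ∀ j : ℕ, H * (F ^ j : Matrix ι ι ℝ) * G = H' * (F' ^ j : Matrix κ κ ℝ) * G')
    {v : ℕ →₀ (n → ℝ)} (hx : x 0 = reach F G v) (hx' : x' 0 = reach F' G' v) (t : ℝ) :
    H *ᵥ x t = H' *ᵥ x' t := by
  let 𝔽 := Matrix.fromBlocks F 0 0 F'
  let 𝔾 := Matrix.fromRows G G'
  have hpow : ∀ j : ℕ, 𝔽 ^ j * 𝔾 = Matrix.fromRows (F ^ j * G) (F' ^ j * G') := by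
    intro j
    induction j with
    | zero => simp [𝔾]
    | succ j ih =>
      rw [pow_succ', Matrix.mul_assoc, ih, pow_succ', pow_succ', Matrix.mul_assoc,
        Matrix.mul_assoc]
      ext (i | i) b <;> simp [𝔽, Matrix.mul_apply]
  have hreach : Sum.elim (x 0) (x' 0) = reach 𝔽 𝔾 v := by
    rw [hx, hx', reach_apply, reach_apply, reach_apply]
    simp only [hpow, Matrix.fromRows_mulVec]
    ext (i | i) <;> simp
  have hsol := h.sumElim h'
  have hZ := forall_mem_of_charpoly_roots (complexify 𝔽) (U := reachableAnnihilator 𝔽 𝔾)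
    (fun r hr z => reachableAnnihilator_shift hr z)
    (Z := fun r => ∀ t, pairing r (Sum.elim (x t) (x' t)) = 0) (fun t => pairing_zero _)
    (fun r hr z _ hz t => by
      rw [hsol.pairing_eq_exp_mul (vecMul_eq_zero_of_mem_reachableAnnihilator hr) hz t, hreach,
        reach_apply, map_sum, Finset.sum_eq_zero, mul_zero]
      intro j _
      rw [pairing_mulVec, hr j, pairing_zero])
  ext a
  -- The difference of the two outputs as a functional of the joint state; equal Markov parameters
  -- say exactly that it annihilates the joint reachable subspace.
  let r : ι ⊕ κ → ℂ := Sum.elim (fun i => ((H a i : ℝ) : ℂ)) (fun i => ((-H' a i : ℝ) : ℂ))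
  have hr : r ∈ reachableAnnihilator 𝔽 𝔾 := by
    intro j
    ext b
    have := congrArg (fun M => ((M a b : ℝ) : ℂ)) (hmarkov j)
    simp only [Matrix.mul_assoc, Matrix.mul_apply (M := H), Matrix.mul_apply (M := H')] at this
    rw [hpow]
    simp only [Matrix.vecMul, dotProduct, complexify, Fintype.sum_sum_type, r, Sum.elim_inl,
      Sum.elim_inr, Matrix.map_apply, Matrix.fromRows_apply_inl, Matrix.fromRows_apply_inr,
      Complex.coe_algebraMap, Complex.ofReal_neg, neg_mul, Finset.sum_neg_distrib]
    push_cast at this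
    rw [Pi.zero_apply, ← sub_eq_add_neg, sub_eq_zero]
    exact this
  have h0 := hZ r hr t
  rw [pairing_sumElim, pairing_ofReal (H a), pairing_ofReal (fun i => -H' a i),
    ← Complex.ofReal_add, Complex.ofReal_eq_zero] at h0
  have h1 : (fun i => -H' a i) ⬝ᵥ x' t = -(H' a ⬝ᵥ x' t) := neg_dotProduct _ _
  rw [h1, ← sub_eq_add_neg, sub_eq_zero] at h0
  exact h0

end PathSolution

/-! ### Two-sided Lévy processes and state processes -/

section Processes

variable {Ω : Type*} [MeasurableSpace Ω] {μ : Measure Ω}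

/-- One-sided limits of a path agree with those of its left limits. -/
lemma tendsto_of_tendsto_left_limits {E : Type*} [TopologicalSpace E] [RegularSpace E]
    {f g : ℝ≥0 → E} {S : Set ℝ≥0} (hS : IsOpen S) {τ : ℝ≥0} {a : E}
    (hf : Tendsto f (𝓝[S] τ) (𝓝 a))
    (hg : ∀ u ∈ S, 0 < u ∧ Tendsto f (𝓝[<] u) (𝓝 (g u))) : Tendsto g (𝓝[S] τ) (𝓝 a) := by
  -- Closed neighbourhoods are used because g(u) is a limit of values of f, which stays in V only if
  -- V is closed.
  refine (closed_nhds_basis a).tendsto_right_iff.2 fun V ⟨hV, hVc⟩ => ?_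
  have h1 := eventually_eventually_nhdsWithin.2 (hf.eventually hV)
  filter_upwards [h1, self_mem_nhdsWithin] with u hu huS
  obtain ⟨hu0, hlim⟩ := hg u huS
  rw [hS.nhdsWithin_eq huS] at hu
  have : (𝓝[<] u).NeBot := nhdsLT_neBot_of_exists_lt ⟨0, hu0⟩
  exact hVc.mem_of_tendsto hlim (hu.filter_mono nhdsWithin_le_nhds)

lemma tendsto_toNNReal_nhdsGE (t : ℝ) :
    Tendsto Real.toNNReal (𝓝[≥] t) (𝓝[≥] t.toNNReal) :=
  tendsto_nhdsWithin_iff.2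
    ⟨(continuous_real_toNNReal.tendsto t).mono_left nhdsWithin_le_nhds, by
      filter_upwards [self_mem_nhdsWithin] with s hs using Real.toNNReal_le_toNNReal hs⟩

lemma tendsto_toNNReal_nhdsLT {t : ℝ} (ht : 0 < t) :
    Tendsto Real.toNNReal (𝓝[<] t) (𝓝[<] t.toNNReal) :=
  tendsto_nhdsWithin_iff.2
    ⟨(continuous_real_toNNReal.tendsto t).mono_left nhdsWithin_le_nhds, by
      filter_upwards [self_mem_nhdsWithin] with s hs
      exact (Real.toNNReal_lt_toNNReal_iff ht).2 hs⟩

variable {m : ℕ} {L : ℝ → Ω → Fin m → ℝ}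

/-- On the negative axis, L is minus the time reversal of the left limits of L₂. Taking left limits
gives a left-continuous path with right limits, and reversing time exchanges the two sides. -/
lemma IsTwoSidedLevyProcess.isCadlag (h : IsTwoSidedLevyProcess μ L) (ω : Ω) :
    IsCadlag fun t => L t ω := by
  obtain ⟨L₁, L₂, h₁, h₂, -, -, hpos, hneg⟩ := h
  have hp : ∀ t : ℝ, 0 ≤ t → L t ω = L₁ t.toNNReal ω := fun t ht => by
    rw [← hpos, Real.coe_toNNReal t ht]
  let g : ℝ≥0 → Fin m → ℝ := fun u => -(L (-(u : ℝ)) ω)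
  have hg : ∀ t : ℝ, t ≤ 0 → -g (-t).toNNReal = L t ω := by
    intro t ht
    simp only [g]
    rw [Real.coe_toNNReal _ (neg_nonneg.2 ht), neg_neg, neg_neg]
  have hlim : ∀ u : ℝ≥0, 0 < u → Tendsto (fun s => L₂ s ω) (𝓝[<] u) (𝓝 (g u)) :=
    fun u hu => hneg u ω hu
  intro t
  constructor
  · rcases le_or_gt 0 t with ht | ht
    · have h1 : ContinuousWithinAt (fun s : ℝ => L₁ s.toNNReal ω) (Set.Ici t) t :=
        ((h₁.cadlag ω t.toNNReal).1.tendsto).comp (tendsto_toNNReal_nhdsGE t)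
      exact h1.congr (fun s hs => hp s (ht.trans hs)) (hp t ht)
    · have hτ : 0 < (-t).toNNReal := Real.toNNReal_pos.2 (neg_pos.2 ht)
      have h1 : Tendsto g (𝓝[<] (-t).toNNReal) (𝓝 (g (-t).toNNReal)) := by
        have := tendsto_of_tendsto_left_limits (g := g) (isOpen_Ioo (a := 0) (b := (-t).toNNReal))
          (by rw [nhdsWithin_Ioo_eq_nhdsLT hτ]; exact hlim _ hτ) fun u hu => ⟨hu.1, hlim u hu.1⟩
        rwa [nhdsWithin_Ioo_eq_nhdsLT hτ] at this
      have h2 : Tendsto (fun s : ℝ => (-s).toNNReal) (𝓝[>] t) (𝓝[<] (-t).toNNReal) :=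
        (tendsto_toNNReal_nhdsLT (neg_pos.2 ht)).comp (tendsto_neg_nhdsGT (a := t))
      have h3 : ContinuousWithinAt (fun s => L s ω) (Set.Ioi t) t := by
        have h4 := (h1.comp h2).neg
        rw [hg t ht.le] at h4
        refine Tendsto.congr' ?_ h4
        filter_upwards [Ioo_mem_nhdsGT ht] with s hs
        exact hg s hs.2.le
      exact continuousWithinAt_Ioi_iff_Ici.1 h3
  · rcases lt_or_ge 0 t with ht | ht
    · obtain ⟨l, hl⟩ := (h₁.cadlag ω t.toNNReal).2
      refine ⟨l, (hl.comp (tendsto_toNNReal_nhdsLT ht)).congr' ?_⟩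
      filter_upwards [Ioo_mem_nhdsLT ht] with s hs
      exact (hp s hs.1.le).symm
    · refine ⟨-(L₂ (-t).toNNReal ω), ?_⟩
      have h1 : Tendsto g (𝓝[>] (-t).toNNReal) (𝓝 (L₂ (-t).toNNReal ω)) :=
        tendsto_of_tendsto_left_limits isOpen_Ioi
          ((h₂.cadlag ω _).1.tendsto.mono_left (nhdsWithin_mono _ Set.Ioi_subset_Ici_self))
          fun u hu => ⟨lt_of_le_of_lt zero_le hu, hlim u (lt_of_le_of_lt zero_le hu)⟩
      have h2 : Tendsto (fun s : ℝ => (-s).toNNReal) (𝓝[<] t) (𝓝[>] (-t).toNNReal) := by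
        refine tendsto_nhdsWithin_iff.2 ⟨((continuous_real_toNNReal.comp continuous_neg).tendsto
          t).mono_left nhdsWithin_le_nhds, ?_⟩
        filter_upwards [self_mem_nhdsWithin] with s (hs : s < t)
        exact (Real.toNNReal_lt_toNNReal_iff (by linarith)).2 (neg_lt_neg hs)
      refine (h1.comp h2).neg.congr' ?_
      filter_upwards [self_mem_nhdsWithin] with s (hs : s < t)
      exact hg s (hs.le.trans ht)

lemma IsTwoSidedLevyProcess.measurable (h : IsTwoSidedLevyProcess μ L) (t : ℝ) :
    Measurable (L t) := by
  obtain ⟨L₁, L₂, h₁, h₂, -, -, hpos, hneg⟩ := h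
  rcases le_or_gt 0 t with ht | ht
  · have : L t = L₁ t.toNNReal := by
      ext1 ω
      rw [← hpos, Real.coe_toNNReal t ht]
    exact this ▸ h₁.measurable _
  · have hτ : 0 < (-t).toNNReal := Real.toNNReal_pos.2 (neg_pos.2 ht)
    have : (𝓝[<] (-t).toNNReal).NeBot := nhdsLT_neBot_of_exists_lt ⟨0, hτ⟩
    obtain ⟨u, hu⟩ := exists_seq_tendsto (𝓝[<] (-t).toNNReal)
    refine measurable_of_tendsto_metrizable (f := fun k ω => -(L₂ (u k) ω))
      (fun k => (h₂.measurable (u k)).neg) (tendsto_pi_nhds.2 fun ω => ?_)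
    have h1 := ((hneg _ ω hτ).comp hu).neg
    rwa [neg_neg, Real.coe_toNNReal _ (neg_pos.2 ht).le, neg_neg] at h1

/-- The state equation can be solved with any measurable initial value. -/
lemma exists_state_process {κ : Type*} [Fintype κ] (hL : ∀ t, Measurable (L t))
    (hc : ∀ ω, IsCadlag fun t => L t ω) (F : Matrix κ κ ℝ) (G : Matrix κ (Fin m) ℝ)
    {ξ : Ω → κ → ℝ} (hξ : Measurable ξ) :
    ∃ X : ℝ → Ω → κ → ℝ, (∀ t, Measurable (X t)) ∧
      ∀ ω, IsPathSolution F G (fun t => L t ω) (fun t => X t ω) ∧ X 0 ω = ξ ω := by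
  let T : (κ → ℝ) →L[ℝ] (κ → ℝ) := F.mulVecLin.toContinuousLinearMap
  let b : ℝ → Ω → κ → ℝ := fun t ω => G *ᵥ L t ω
  have hG : Continuous fun y : Fin m → ℝ => G *ᵥ y := by fun_prop
  have hb : ∀ t, Measurable (b t) := fun t => hG.measurable.comp (hL t)
  have hbc : ∀ ω, IsCadlag fun t => b t ω := fun ω => (hc ω).comp_continuous hG
  have hjoint : Measurable (Function.uncurry b) :=
    measurable_uncurry_of_right_continuous hb fun ω t => (hbc ω t).1
  -- Subtracting the input b = GL leaves w = X - b, which solves w' = F(w + b) without any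
  -- stochastic integral.
  let w : ℝ → Ω → κ → ℝ := fun t ω =>
    variationOfConstants T (fun u => b u ω) (ξ ω - b 0 ω) t
  refine ⟨fun t ω => w t ω + b t ω, fun t =>
    (measurable_variationOfConstants T hjoint (hξ.sub (hb 0)) t).add (hb t), fun ω => ⟨⟨?_, ?_⟩, ?_⟩⟩
  · exact ((isCadlag_of_continuous (variationOfConstants_spec T (hbc ω) _).1).prodMk
      (hbc ω)).comp_continuous continuous_add
  · intro s t _
    have h1 := (variationOfConstants_spec T (hbc ω) (ξ ω - b 0 ω)).2 s t
    rw [add_sub_add_comm, show w t ω - w s ω = _ from h1, Matrix.mulVec_sub]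
    rfl
  · simp only [w, variationOfConstants_zero, sub_add_cancel]

variable {ι : Type*} [Fintype ι]

/-- A stationary process cannot grow or decay exponentially along a linear functional. -/
lemma IsStrictlyStationary.pairing_eq_zero [IsProbabilityMeasure μ] {X : ℝ → Ω → ι → ℝ}
    (hX : IsStrictlyStationary μ X) {r : ι → ℂ} {z : ℂ} (hz : z.re ≠ 0)
    (h : ∀ᵐ ω ∂μ, ∀ t : ℝ, pairing r (X t ω) = Complex.exp (t * z) * pairing r (X 0 ω)) :
    ∀ᵐ ω ∂μ, pairing r (X 0 ω) = 0 := by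
  -- At this time, possibly negative, the modulus of the functional has exactly doubled.
  obtain ⟨τ, hτ⟩ : ∃ τ : ℝ, τ * z.re = Real.log 2 := ⟨Real.log 2 / z.re, div_mul_cancel₀ _ hz⟩
  -- Boundedness of arctan gives integrability without moment assumptions. Equal laws give equal
  -- expectations, and strict monotonicity then turns the pointwise inequality into almost sure
  -- equality.
  have hφ : Continuous fun y : Fin 1 → ι → ℝ => Real.arctan ‖pairing r (y 0)‖ :=
    Real.continuous_arctan.comp ((pairing r).continuous.comp (continuous_apply 0)).norm
  have h0 := hX 1 (fun _ => 0) τ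
  simp only [zero_add] at h0
  have hid : IdentDistrib (fun ω => Real.arctan ‖pairing r (X τ ω)‖)
      (fun ω => Real.arctan ‖pairing r (X 0 ω)‖) μ μ := h0.comp hφ.measurable
  have hbd : ∀ y, ‖Real.arctan y‖ ≤ Real.pi / 2 := fun y =>
    abs_le.2 ⟨(Real.neg_pi_div_two_lt_arctan y).le, (Real.arctan_lt_pi_div_two y).le⟩
  have hi1 : Integrable (fun ω => Real.arctan ‖pairing r (X τ ω)‖) μ :=
    Integrable.of_bound hid.aemeasurable_fst.aestronglyMeasurable (Real.pi / 2)
      (Eventually.of_forall fun ω => hbd _)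
  have hi2 : Integrable (fun ω => Real.arctan ‖pairing r (X 0 ω)‖) μ :=
    Integrable.of_bound hid.aemeasurable_snd.aestronglyMeasurable (Real.pi / 2)
      (Eventually.of_forall fun ω => hbd _)
  have hnorm : ∀ᵐ ω ∂μ, ‖pairing r (X τ ω)‖ = 2 * ‖pairing r (X 0 ω)‖ := by
    filter_upwards [h] with ω hω
    rw [hω τ, norm_mul, Complex.norm_exp, Complex.re_ofReal_mul, hτ, Real.exp_log two_pos]
  have hint := sub_eq_zero.2 hid.integral_eq
  rw [← integral_sub hi1 hi2] at hint
  have hnonneg : ∀ᵐ ω ∂μ, 0 ≤ Real.arctan ‖pairing r (X τ ω)‖ - Real.arctan ‖pairing r (X 0 ω)‖ := by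
    filter_upwards [hnorm] with ω h1
    refine sub_nonneg.2 (Real.arctan_strictMono.monotone ?_)
    rw [h1]
    linarith [norm_nonneg (pairing r (X 0 ω))]
  filter_upwards [(integral_eq_zero_iff_of_nonneg_ae hnonneg (hi1.sub hi2)).1 hint, hnorm]
    with ω h1 h2
  have h4 := Real.arctan_injective (sub_eq_zero.1 h1)
  rw [h2] at h4
  exact norm_eq_zero.1 (by linarith)

/-- A stationary solution of a hyperbolic state equation stays in the reachable subspace. -/
lemma IsStrictlyStationary.mem_range_reach [IsProbabilityMeasure μ] [DecidableEq ι]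
    {X : ℝ → Ω → ι → ℝ} (hX : IsStrictlyStationary μ X) {F : Matrix ι ι ℝ}
    {G : Matrix ι (Fin m) ℝ}
    (hsol : ∀ᵐ ω ∂μ, IsPathSolution F G (fun t => L t ω) (fun t => X t ω))
    (hF : ∀ z, (complexify F).charpoly.IsRoot z → z.re ≠ 0) :
    ∀ᵐ ω ∂μ, X 0 ω ∈ LinearMap.range (reach F G) := by
  obtain ⟨K, hK, hKx⟩ := exists_matrix_ker_eq_range_reach F G
  have hZ := forall_mem_of_charpoly_roots (complexify F) (U := reachableAnnihilator F G)
    (fun r hr z => reachableAnnihilator_shift hr z)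
    (Z := fun r => ∀ᵐ ω ∂μ, ∀ t, pairing r (X t ω) = 0)
    (Eventually.of_forall fun ω t => pairing_zero _)
    (fun r hr z hz hr' => by
      have h1 : ∀ᵐ ω ∂μ, ∀ t : ℝ,
          pairing r (X t ω) = Complex.exp (t * z) * pairing r (X 0 ω) := by
        filter_upwards [hsol, hr'] with ω hω hrω
        exact hω.pairing_eq_exp_mul (vecMul_eq_zero_of_mem_reachableAnnihilator hr) hrω
      filter_upwards [h1, hX.pairing_eq_zero (hF z hz) h1] with ω hω h0 t
      rw [hω t, h0, mul_zero])
  have hall : ∀ᵐ ω ∂μ, ∀ i, ∀ t, pairing (fun j => ((K i j : ℝ) : ℂ)) (X t ω) = 0 :=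
    ae_all_iff.2 fun i => hZ _ (hK i)
  filter_upwards [hall] with ω hω
  refine hKx _ (funext fun i => ?_)
  have := hω i 0
  rwa [pairing_ofReal (K i), Complex.ofReal_eq_zero] at this

end Processes

/-! ### The controller canonical form -/

section Controller

variable {d m : ℕ}

/-- A nonzero r in the annihilator with r(F - z) = 0 would be a left eigenvector with rG = 0, hence
yield a nonzero common left null vector of P(z) and Q(z). -/
lemma eq_zero_of_leftCoprime {p q : ℕ} (hpq : q < p) {A : ℕ → Matrix (Fin d) (Fin d) ℝ}
    {B : ℕ → Matrix (Fin d) (Fin m) ℝ} (h : LeftCoprime (arPoly p A) (maPoly q B)) :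
    ∀ r ∈ reachableAnnihilator (companion p A) (observerInput p q A B), r = 0 := by
  refine forall_mem_of_charpoly_roots (complexify (companion p A))
    (fun r hr z => reachableAnnihilator_shift hr z) (Z := fun r => r = 0) rfl
    fun r hr z _ hz => ?_
  by_contra hr0
  obtain ⟨v, hv0, hvP, hvQ⟩ := exists_left_null_of_eigenvector hpq B (sub_eq_zero.1 hz) hr0
  rw [vecMul_eq_zero_of_mem_reachableAnnihilator hr] at hvQ
  exact hv0 (h.eq_zero_of_vecMul hvP hvQ)

lemma mem_range_reach_of_leftCoprime {p q : ℕ} (hpq : q < p) {A : ℕ → Matrix (Fin d) (Fin d) ℝ}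
    {B : ℕ → Matrix (Fin d) (Fin m) ℝ} (h : LeftCoprime (arPoly p A) (maPoly q B))
    (x : Fin p × Fin d → ℝ) :
    x ∈ LinearMap.range (reach (companion p A) (observerInput p q A B)) := by
  obtain ⟨K, hK, hKx⟩ := exists_matrix_ker_eq_range_reach (companion p A) (observerInput p q A B)
  refine hKx x (funext fun i => ?_)
  have h0 := congrArg (fun r => pairing r x) (eq_zero_of_leftCoprime hpq h _ (hK i))
  simp only [pairing_zero] at h0
  rwa [pairing_ofReal (K i), Complex.ofReal_eq_zero] at h0

lemma IsStateSpaceRepresentation.ae_isPathSolution {Ω : Type*} [MeasurableSpace Ω] {μ : Measure Ω}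
    {ι : Type*} [Fintype ι] {F : Matrix ι ι ℝ} {G : Matrix ι (Fin m) ℝ} {H : Matrix (Fin d) ι ℝ}
    {L : ℝ → Ω → Fin m → ℝ} {X : ℝ → Ω → ι → ℝ} {Y : ℝ → Ω → Fin d → ℝ}
    (h : IsStateSpaceRepresentation μ F G H L X Y) :
    ∀ᵐ ω ∂μ, IsPathSolution F G (fun t => L t ω) (fun t => X t ω) := by
  filter_upwards [h.cadlag, h.state] with ω h1 h2
  exact ⟨h1, h2⟩

/-- A representation with reachable initial value can be transferred to any system with the same
Markov parameters. -/
lemma IsStateSpaceRepresentation.exists_of_markov_eq {Ω : Type*} [MeasurableSpace Ω]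
    {μ : Measure Ω} {ι κ : Type*} [Fintype ι] [DecidableEq ι] [Fintype κ] [DecidableEq κ]
    {F : Matrix ι ι ℝ} {G : Matrix ι (Fin m) ℝ} {H : Matrix (Fin d) ι ℝ}
    {F' : Matrix κ κ ℝ} {G' : Matrix κ (Fin m) ℝ} {H' : Matrix (Fin d) κ ℝ}
    {L : ℝ → Ω → Fin m → ℝ} {X : ℝ → Ω → ι → ℝ} {Y : ℝ → Ω → Fin d → ℝ}
    (h : IsStateSpaceRepresentation μ F G H L X Y) (hL : IsTwoSidedLevyProcess μ L)
    (hmarkov : ∀ j : ℕ, H * (F ^ j : Matrix ι ι ℝ) * G = H' * (F' ^ j : Matrix κ κ ℝ) * G')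
    (h0 : ∀ᵐ ω ∂μ, X 0 ω ∈ LinearMap.range (reach F G)) :
    ∃ X' : ℝ → Ω → κ → ℝ, IsStateSpaceRepresentation μ F' G' H' L X' Y := by
  obtain ⟨T, hT⟩ := exists_linearMap_reach F G F' G'
  obtain ⟨X', hm, hX'⟩ := exists_state_process hL.measurable hL.isCadlag F' G'
    (T.continuous_of_finiteDimensional.measurable.comp (h.measurable 0))
  refine ⟨X', hm, Eventually.of_forall fun ω => (hX' ω).1.cadlag,
    Eventually.of_forall fun ω => (hX' ω).1.state, ?_⟩
  filter_upwards [h.ae_isPathSolution, h.output, h0] with ω hsol hY hω t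
  obtain ⟨v, hv, hTv⟩ := hT _ hω
  rw [hY t]
  exact hsol.output_eq (hX' ω).1 hmarkov hv ((hX' ω).2.trans hTv) t

lemma evalAt_scalar {n : Type*} [Fintype n] [DecidableEq n] (g : ℝ[X]) (z : ℂ) :
    evalAt (g • (1 : Matrix n n ℝ[X])) z = aeval z g • (1 : Matrix n n ℂ) := by
  rw [evalAt_smul, evalAt_one]

/-- Equality of Markov parameters from a common fraction with denominator `χ ^ 2`, where `χ` is the
characteristic polynomial of the first system. -/
lemma markov_parameters_eq_of_fraction {ι κ k n : Type} [Fintype ι] [DecidableEq ι] [Fintype κ]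
    [DecidableEq κ] [Fintype n] [DecidableEq n] (F : Matrix ι ι ℝ) (G : Matrix ι n ℝ)
    (H : Matrix k ι ℝ) (F' : Matrix κ κ ℝ) (G' : Matrix κ n ℝ) (H' : Matrix k κ ℝ)
    (V : Matrix κ n ℝ[X])
    (hV : F'.charmatrix * V = (G'.map C : Matrix κ n ℝ[X]) *
      (F.charpoly ^ 2 • (1 : Matrix n n ℝ[X])))
    (hQ : (H'.map C : Matrix k κ ℝ[X]) * V = F.charpoly • ((H.map C : Matrix k ι ℝ[X]) *
      F.charmatrix.adjugate * (G.map C : Matrix ι n ℝ[X]))) (j : ℕ) :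
    H * (F ^ j : Matrix ι ι ℝ) * G = H' * (F' ^ j : Matrix κ κ ℝ) * G' := by
  refine markov_parameters_eq _ _ _ _ j _ _ ?_
  filter_upwards [(tendsto_smul_inv_smul_one_sub F).2,
    (tendsto_smul_inv_smul_one_sub F').2] with x hu hu'
  let ev : ℝ[X] →+* ℝ := evalRingHom x
  have hchar : ∀ {ν : Type} [Fintype ν] [DecidableEq ν] (M : Matrix ν ν ℝ),
      M.charmatrix.map ev = x • (1 : Matrix ν ν ℝ) - M := by
    intro ν _ _ M
    ext i j
    by_cases h : i = j
    · subst h; simp [ev]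
    · simp [ev, h]
  have hC : ∀ {ν ν' : Type} (M : Matrix ν ν' ℝ), (M.map C).map ev = M := by
    intro ν ν' M
    ext i j
    simp [ev]
  have hsmul : ∀ {ν ν' : Type} (f : ℝ[X]) (M : Matrix ν ν' ℝ[X]),
      (f • M).map ev = f.eval x • M.map ev := by
    intro ν ν' f M
    ext i j
    simp [ev]
  set χ := F.charpoly with hχ
  have hχx : χ.eval x = (x • (1 : Matrix ι ι ℝ) - F).det := by
    rw [hχ, Matrix.eval_charpoly, Matrix.scalar_apply, Matrix.smul_one_eq_diagonal]
  have hχ0 : χ.eval x ≠ 0 := hχx ▸ hu.ne_zero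
  let W : Matrix κ n ℝ := V.map ev
  have h1 : (x • (1 : Matrix κ κ ℝ) - F') * W = (χ.eval x) ^ 2 • G' := by
    have h := congrArg (fun M => M.map ev) hV
    rw [Matrix.map_mul, Matrix.map_mul, hchar, hC, hsmul, Matrix.map_one _ (map_zero _) (map_one _),
      eval_pow, Matrix.mul_smul, Matrix.mul_one] at h
    exact h
  have hadj : F.charmatrix.adjugate.map ev = χ.eval x • (x • (1 : Matrix ι ι ℝ) - F)⁻¹ := by
    have h := RingHom.map_adjugate ev F.charmatrix
    rw [RingHom.mapMatrix_apply, RingHom.mapMatrix_apply, hchar] at h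
    rw [h, Matrix.inv_def, smul_smul, ← hχx, Ring.mul_inverse_cancel _
      (isUnit_iff_ne_zero.2 hχ0), one_smul]
  have h2 : H' * W = (χ.eval x) ^ 2 • (H * (x • (1 : Matrix ι ι ℝ) - F)⁻¹ * G) := by
    have h := congrArg (fun M => M.map ev) hQ
    rw [Matrix.map_mul, hC, hsmul, Matrix.map_mul, Matrix.map_mul, hC, hC, hadj, Matrix.mul_smul,
      Matrix.smul_mul, smul_smul, ← pow_two] at h
    exact h
  have hW : W = (x • (1 : Matrix κ κ ℝ) - F')⁻¹ * ((χ.eval x) ^ 2 • G') := by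
    rw [← h1, ← Matrix.mul_assoc, Matrix.nonsing_inv_mul _ hu', Matrix.one_mul]
  rw [hW, Matrix.mul_smul, Matrix.mul_smul, ← Matrix.mul_assoc] at h2
  exact (smul_right_injective _ (pow_ne_zero 2 hχ0) h2).symm

lemma markov_parameters_controller_eq {pt qt p q : ℕ} (hpq : q < p)
    {At : ℕ → Matrix (Fin d) (Fin d) ℝ} {Bt : ℕ → Matrix (Fin d) (Fin m) ℝ}
    {A : ℕ → Matrix (Fin m) (Fin m) ℝ} {B : ℕ → Matrix (Fin d) (Fin m) ℝ}
    (hP : arPoly p A = (companion pt At).charpoly ^ 2 • (1 : Matrix (Fin m) (Fin m) ℝ[X]))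
    (hQ : maPoly q B = numerator pt qt At Bt) (j : ℕ) :
    (observerOutput pt : Matrix (Fin d) (Fin pt × Fin d) ℝ) *
        (companion pt At ^ j : Matrix (Fin pt × Fin d) (Fin pt × Fin d) ℝ) *
        observerInput pt qt At Bt =
      controllerOutput p q B * (companion p A ^ j : Matrix (Fin p × Fin m) (Fin p × Fin m) ℝ) *
        (controllerInput p : Matrix (Fin p × Fin m) (Fin m) ℝ) :=
  markov_parameters_eq_of_fraction _ _ _ _ _ _ (powerColumn (Fin m) p)
    (by rw [charmatrix_companion_mul_powerColumn, hP])
    (by rw [controllerOutput_mul_powerColumn hpq, hQ, numerator]) j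

lemma inv_mul_eq_mul_inv_of_mul_eq_smul {k n : Type*} [Fintype k] [DecidableEq k] [Fintype n]
    [DecidableEq n] {P : Matrix k k ℂ} {Qt Q : Matrix k n ℂ} {c : ℂ} (hc : c ≠ 0)
    (hP : P.det ≠ 0) (h : P * Q = c • Qt) : P⁻¹ * Qt = Q * (c • (1 : Matrix n n ℂ))⁻¹ := by
  have h2 : (c • (1 : Matrix n n ℂ))⁻¹ = c⁻¹ • (1 : Matrix n n ℂ) := by
    refine Matrix.inv_eq_left_inv ?_
    rw [Matrix.smul_mul, Matrix.one_mul, smul_smul, inv_mul_cancel₀ hc, one_smul]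
  have h3 : Qt = c⁻¹ • (P * Q) := by
    rw [h, smul_smul, inv_mul_cancel₀ hc, one_smul]
  rw [h2, h3, Matrix.mul_smul, Matrix.mul_smul, Matrix.mul_one, ← Matrix.mul_assoc,
    Matrix.nonsing_inv_mul _ (isUnit_iff_ne_zero.2 hP), Matrix.one_mul]

/-- The matrix fraction `Q P⁻¹` with scalar denominator `P = χ ^ 2`. -/
lemma exists_right_fraction (hd : 0 < d) {pt qt : ℕ} (hpq : qt < pt)
    (At : ℕ → Matrix (Fin d) (Fin d) ℝ) (Bt : ℕ → Matrix (Fin d) (Fin m) ℝ) :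
    ∃ (p q : ℕ) (A : ℕ → Matrix (Fin m) (Fin m) ℝ) (B : ℕ → Matrix (Fin d) (Fin m) ℝ),
      0 < q ∧ q < p ∧ (maPoly qt Bt ≠ 0 → B q ≠ 0) ∧
      arPoly p A = (companion pt At).charpoly ^ 2 • (1 : Matrix (Fin m) (Fin m) ℝ[X]) ∧
      maPoly q B = numerator pt qt At Bt := by
  have hmonic : (companion pt At).charpoly.Monic := Matrix.charpoly_monic _
  have hdeg : ((companion pt At).charpoly ^ 2).natDegree = 2 * (pt * d) := by
    rw [natDegree_pow, Matrix.charpoly_natDegree_eq_dim, Fintype.card_prod, Fintype.card_fin,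
      Fintype.card_fin]
  obtain ⟨q, hq0, hqp, hdegQ, hlead⟩ :=
    exists_coeff_numerator (by rwa [Fintype.card_fin]) hpq At Bt
  rw [Fintype.card_fin, ← hdeg] at hqp
  refine ⟨_, q, _, _, hq0, hqp, fun hB => ?_, arPoly_scalar (hmonic.pow 2), maPoly_coeff hdegQ⟩
  obtain ⟨a, b, hab⟩ := hlead hB
  exact fun h => hab (congrFun (congrFun h a) b)

end Controller

end MCARMA

theorem mainTheorem5 {d m : ℕ} (hd : 0 < d) (hm : 0 < m)
    -- the AR polynomial `z ^ pt + At 1 z ^ (pt - 1) + ⋯ + At pt` and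
    -- the MA polynomial `Bt 0 + Bt 1 z + ⋯ + Bt qt z ^ qt`
    (pt qt : ℕ) (hpq : qt < pt)
    (At : ℕ → Matrix (Fin d) (Fin d) ℝ) (Bt : ℕ → Matrix (Fin d) (Fin m) ℝ) :
    ∃ (p q : ℕ) (A : ℕ → Matrix (Fin m) (Fin m) ℝ) (B : ℕ → Matrix (Fin d) (Fin m) ℝ),
      0 < q ∧ q < p ∧
      (MCARMA.maPoly qt Bt ≠ 0 → B q ≠ 0) ∧
      (∀ z : ℂ, (MCARMA.evalAt (MCARMA.arPoly p A) z).det = 0 ↔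
        (MCARMA.evalAt (MCARMA.arPoly pt At) z).det = 0) ∧
      (∀ z : ℂ, (MCARMA.evalAt (MCARMA.arPoly pt At) z).det ≠ 0 →
        (MCARMA.evalAt (MCARMA.arPoly pt At) z)⁻¹ * MCARMA.evalAt (MCARMA.maPoly qt Bt) z =
          MCARMA.evalAt (MCARMA.maPoly q B) z * (MCARMA.evalAt (MCARMA.arPoly p A) z)⁻¹) ∧
      (∀ (Ω : Type*) [MeasurableSpace Ω] (μ : Measure Ω) [IsProbabilityMeasure μ]
        (L : ℝ → Ω → Fin m → ℝ) (Y : ℝ → Ω → Fin d → ℝ),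
        MCARMA.IsTwoSidedLevyProcess μ L →
        MCARMA.IsMCARMA μ pt qt At Bt L Y →
        (MCARMA.LeftCoprime (MCARMA.arPoly pt At) (MCARMA.maPoly qt Bt) ∨
          ((∀ z : ℂ, (MCARMA.evalAt (MCARMA.arPoly pt At) z).det = 0 → z.re ≠ 0) ∧
            MCARMA.IsStationaryMCARMA μ pt qt At Bt L Y)) →
        ∃ X : ℝ → Ω → Fin p × Fin m → ℝ,
          MCARMA.IsStateSpaceRepresentation μ (MCARMA.companion p A) (MCARMA.controllerInput p)
            (MCARMA.controllerOutput p q B) L X Y) := by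
  obtain ⟨p, q, A, B, hq0, hqp, hB, hP, hQ⟩ := MCARMA.exists_right_fraction hd hpq At Bt
  have hzero := MCARMA.aeval_charpoly_companion_eq_zero_iff (Nat.zero_lt_of_lt hpq) At
  refine ⟨p, q, A, B, hq0, hqp, hB, fun z => ?_, fun z hz => ?_, ?_⟩
  · rw [hP, MCARMA.evalAt_scalar, Matrix.det_smul, Matrix.det_one, mul_one, map_pow,
      -- The determinant of χ²·1 is χ to the power 2m, which has the zeros of χ because m > 0.
      Fintype.card_fin, pow_eq_zero_iff hm.ne', pow_eq_zero_iff two_ne_zero, hzero]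
  · have h := congrArg (fun M => MCARMA.evalAt M z) (MCARMA.arPoly_mul_numerator hpq At Bt)
    simp only [MCARMA.evalAt_mul, MCARMA.evalAt_smul] at h
    rw [hP, hQ, MCARMA.evalAt_scalar]
    refine MCARMA.inv_mul_eq_mul_inv_of_mul_eq_smul ?_ hz h
    rw [map_pow]
    exact pow_ne_zero 2 fun h0 => hz ((hzero z).1 h0)
  · intro Ω _ μ _ L Y hL hY hcases
    have hmarkov := MCARMA.markov_parameters_controller_eq hqp hP hQ
    rcases hcases with hcop | ⟨himag, X, hX, hstat⟩
    · obtain ⟨X, hX⟩ := hY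
      exact hX.exists_of_markov_eq hL hmarkov (Eventually.of_forall fun ω =>
        MCARMA.mem_range_reach_of_leftCoprime hpq hcop _)
    -- The representation transferred here is the one whose state is stationary, not the arbitrary
    -- one in `hY`.
    · refine hX.exists_of_markov_eq hL hmarkov (hstat.mem_range_reach hX.ae_isPathSolution ?_)
      intro z hz
      refine himag z ((hzero z).1 ?_)
      rwa [MCARMA.aeval_charpoly_eq_eval]
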